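/- Let $B=(-1,1)$, let $\delta(x)=1-x^2$ for $x\in B$ and $\delta(x)=0$ for $x\in\mathbb R\setminus B$, and for $s>0$ and $x\ne y$ let $$G_s(x,y)=\frac{2^{1-2s}}{2\,\Gamma(s)^2}\,|x-y|^{2s-1}\int_0^{\delta(x)\delta(y)|x-y|^{-2}}\frac{t^{s-1}}{(t+1)^{1/2}}\,dt$$ be the Green function of $(-\Delta)^s$ in $B$ (Boggio's formula in dimension one). Let $w:\mathbb R\to\mathbb R$ be given by $$w(x)=\int_B G_1(x,z)\int_B G_{1/2}(z,y)\,dy\,dz .$$ For $x\in B$ let, for functions $u$ for which the respective integral converges absolutely, $$(-\Delta)^{3/2}u(x)=\frac{3}{4\pi}\int_{\mathbb R}\frac{u(x+2y)-4u(x+y)+6u(x)-4u(x-y)+u(x-2y)}{|y|^{4}}\,dy,\qquad (-\Delta)^{1/2}u(x)=\frac1{2\pi}\int_{\mathbb R}\frac{2u(x)-u(x+y)-u(x-y)}{|y|^{2}}\,dy$$ (the constants are those for which the Fourier symbols are $|\xi|^3$ and $|\xi|$). Then the integrals defining $w$ converge, $w\in C^\infty(B)$, $\int_{\mathbb R}|w(x)|/(1+|x|^2)\,dx<\infty$,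 $(-\Delta)^{3/2}w(x)$ is well defined for every $x\in B$, and $(-\Delta)^{3/2}w$ is not identically $1$ in $B$. In particular, $(-\Delta)$ and $(-\Delta)^{1/2}$ cannot be interchanged here: $(-\Delta)^{1/2}w$ is well defined and of class $C^2$ in $B$, $w$ is $C^\infty$ in $\mathbb R\setminus\{-1,1\}$, and for every $g:\mathbb R\to\mathbb R$ with $g=-\Delta w=-w''$ in $\mathbb R\setminus\{-1,1\}$ the function $(-\Delta)^{1/2}g$ is well defined in $B$ and there is $x\in B$ with $(-\Delta)\big[(-\Delta)^{1/2}w\big](x)\neq(-\Delta)^{1/2}g(x)$. -/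

import Mathlib

open MeasureTheory
open scoped ContDiff Laplacian

namespace FracGreen

noncomputable section

/-- The unit ball `B = (-1, 1)` of the real line. -/
def B : Set ℝ := Set.Ioo (-1) 1

/-- `δ(x) = 1 - |x|²` if this is positive, and `0` otherwise. -/
def delta (x : ℝ) : ℝ := if 0 < 1 - |x| ^ 2 then 1 - |x| ^ 2 else 0

/-- The surface measure `ω_N = 2 π^{N/2} / Γ(N/2)` of the unit sphere of `ℝ^N`. -/
def omega (N : ℕ) : ℝ := 2 * Real.pi ^ ((N : ℝ) / 2) * (Real.Gamma ((N : ℝ) / 2))⁻¹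

/-- The constant `k_{N,s} = 2^{1-2s} / (ω_N Γ(s)²)` of Boggio's formula. -/
def boggioConst (N : ℕ) (s : ℝ) : ℝ := 2 ^ (1 - 2 * s) / (omega N * Real.Gamma s ^ 2)

/-- `ρ(x,y) = δ(x) δ(y) |x-y|⁻²`, for `x ≠ y`. -/
def rho (x y : ℝ) : ℝ := delta x * delta y / |x - y| ^ 2

/-- Boggio's formula in dimension one: the Green function `G_s(x,y)`, `x ≠ y`, of `(-Δ)^s` in
`B = (-1,1)`. The value on the diagonal is irrelevant, since `G_s` is only integrated in `y`. -/
def green (s x y : ℝ) : ℝ :=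
  boggioConst 1 s * |x - y| ^ (2 * s - 1) *
    ∫ t in (0 : ℝ)..rho x y, t ^ (s - 1) / (t + 1) ^ ((1 : ℝ) / 2)

/-- `w₁(z) = ∫_B G_{1/2}(z,y) dy`. -/
def w₁ (z : ℝ) : ℝ := ∫ y in B, green (1 / 2) z y

/-- `w(x) = ∫_B G_1(x,z) ∫_B G_{1/2}(z,y) dy dz`, as a function on the whole real line. -/
def w (x : ℝ) : ℝ := ∫ z in B, green 1 x z * w₁ z

/-- The weighted space `𝓛¹_t` of locally integrable functions on the real line with
`∫ |u(x)| / (1 + |x|^{1+2t}) dx < ∞`; it grows with `t`. -/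
def MemWeightedL1 (t : ℝ) (u : ℝ → ℝ) : Prop :=
  LocallyIntegrable u ∧ Integrable fun x : ℝ => |u x| / (1 + |x| ^ (1 + 2 * t))

/-- The normalization constant for which the operator `fracLapLow σ` below has Fourier symbol
`|ξ|^{2σ}`, `σ ∈ (0,1)`; for `σ = 1/2` it is `1/(2π)`. -/
def lowConst (σ : ℝ) : ℝ :=
  -(4 ^ σ * Real.Gamma (1 / 2 + σ)) / (2 * Real.pi ^ ((1 : ℝ) / 2) * Real.Gamma (-σ))

/-- The integrand `(2u(x) - u(x+y) - u(x-y)) / |y|^{1+2σ}` of the hypersingular integral. -/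
def lowIntegrand (σ : ℝ) (u : ℝ → ℝ) (x y : ℝ) : ℝ :=
  (2 * u x - u (x + y) - u (x - y)) / |y| ^ (1 + 2 * σ)

/-- The pointwise fractional Laplacian `(-Δ)^σ u(x)` on the real line for `σ ∈ (0,1)`. -/
def fracLapLow (σ : ℝ) (u : ℝ → ℝ) (x : ℝ) : ℝ :=
  lowConst σ * ∫ y : ℝ, lowIntegrand σ u x y

/-- The normalization constant for which the operator `fracLapHigh s` below has Fourier symbol
`|ξ|^{2s}`, `s ∈ (1,2)`; for `s = 3/2` it is `3/(4π)`. -/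
def highConst (s : ℝ) : ℝ :=
  Real.Gamma (1 / 2 + s) /
    (2 * Real.pi ^ ((1 : ℝ) / 2) * Real.Gamma (-s) * (1 - 4 ^ (1 - s)))

/-- The integrand `(u(x+2y) - 4u(x+y) + 6u(x) - 4u(x-y) + u(x-2y)) / |y|^{1+2s}`. -/
def highIntegrand (s : ℝ) (u : ℝ → ℝ) (x y : ℝ) : ℝ :=
  (u (x + 2 * y) - 4 * u (x + y) + 6 * u x - 4 * u (x - y) + u (x - 2 * y)) /
    |y| ^ (1 + 2 * s)

/-- The pointwise higher-order fractional Laplacian `(-Δ)^s u(x)` on the real line for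
`s ∈ (1,2)`, through fourth order finite differences. -/
def fracLapHigh (s : ℝ) (u : ℝ → ℝ) (x : ℝ) : ℝ :=
  highConst s * ∫ y : ℝ, highIntegrand s u x y

end

end FracGreen

namespace FracGreen

/-! Everything is explicit. `w₁` is the semicircle `semi`, and solving `-w'' = semi` in `B` with
zero boundary values gives `w = profile` in `B` and `w = 0` outside (`w₁_eq`, `w_eq_profile`). But
`w` meets the boundary at an angle: `w'` jumps by `π/4` at each of `±1`, so the distributional
`-w''` carries point masses at `±1` that the pointwise `-w''` does not see. A nonlocal operator
feels them inside `B`.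

For the interchange, `w'` is split into `slope`, which is constant on each side of `B`, and the two
jumps. The first has half-Laplacian `-x`, the jumps add `-1/(4(1-x)) + 1/(4(1+x))`
(`fracLapLow_wDeriv`). Since `(-Δ)^{1/2} w` may be differentiated under the integral
(`hasDerivAt_fracLapLow_w`), `(-Δ)(-Δ)^{1/2} w = 1 + 1/(4(1-x)²) + 1/(4(1+x)²)`, which is `3/2` at
`0`, whereas `(-Δ)^{1/2} semi` is `1` there (`fracLapLow_semi_zero`).

For `(-Δ)^{3/2} w`, evenness and scaling reduce the value at `0` to `(12/π) ∫ wRem t / t⁴` over `(0,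
∞)`, with `wRem` the second order Taylor remainder. It is nonnegative, and its part on `t > 1`,
where `w = 0`, already gives the lower bound `22/(3π) - 1 > 1`. -/

/-- If `f` and `g` are continuous on an open interval and `f' = g` off a countable set, then
`f' = g` on the whole interval. -/
lemma hasDerivAt_of_off_countable {f g : ℝ → ℝ} {I s : Set ℝ} (hI : IsOpen I)
    (hIc : I.OrdConnected) (hs : s.Countable)
    (hf : ContinuousOn f I) (hg : ContinuousOn g I)
    (h : ∀ t ∈ I, t ∉ s → HasDerivAt f (g t) t) {t : ℝ} (ht : t ∈ I) :
    HasDerivAt f (g t) t := by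
  have hint : ∀ u ∈ I, Set.uIcc t u ⊆ I := fun u hu => hIc.uIcc_subset ht hu
  -- The fundamental theorem of calculus tolerates countably many exceptional points; continuity of
  -- `g` then gives differentiability everywhere.
  have key : ∀ u ∈ I, f u = f t + ∫ z in t..u, g z := by
    intro u hu
    rw [integral_eq_of_hasDerivAt_off_countable f g hs (hf.mono (hint u hu)) _
      ((hg.mono (hint u hu)).intervalIntegrable)]
    · ring
    · rintro z ⟨hz, hzs⟩
      exact h z (hint u hu (Set.Ioo_subset_Icc_self hz)) hzs
  have hd : HasDerivAt (fun u => f t + ∫ z in t..u, g z) (g t) t := by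
    refine HasDerivAt.const_add _ ?_
    refine intervalIntegral.integral_hasDerivAt_right (by simp) ?_
      (hg.continuousAt (hI.mem_nhds ht))
    exact ContinuousOn.stronglyMeasurableAtFilter hI hg t ht
  refine hd.congr_of_eventuallyEq ?_
  filter_upwards [hI.mem_nhds ht] with u hu using key u hu

/-! ### The semicircle and its iterated antiderivatives -/

/-- The semicircle `√(1 - t²)`, extended by `0`. -/
noncomputable def semi (t : ℝ) : ℝ := √(1 - t ^ 2)

/-- The antiderivative `-(t √(1 - t²) + arcsin t) / 2` of `-semi`. -/
noncomputable def slope (t : ℝ) : ℝ := -(t * semi t + Real.arcsin t) / 2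

/-- The antiderivative of `slope` that vanishes at `±1`. -/
noncomputable def profile (t : ℝ) : ℝ :=
  semi t ^ 3 / 6 - (t * Real.arcsin t + semi t) / 2 + Real.pi / 4

lemma continuous_semi : Continuous semi := by unfold semi; fun_prop

lemma continuous_slope : Continuous slope := by
  have := continuous_semi
  have := Real.continuous_arcsin
  unfold slope; fun_prop

lemma continuous_profile : Continuous profile := by
  have := continuous_semi
  have := Real.continuous_arcsin
  unfold profile; fun_prop

lemma semi_nonneg (t : ℝ) : 0 ≤ semi t := Real.sqrt_nonneg _

lemma semi_le_one (t : ℝ) : semi t ≤ 1 := by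
  unfold semi
  exact Real.sqrt_le_iff.2 ⟨zero_le_one, by nlinarith [sq_nonneg t]⟩

lemma semi_neg (t : ℝ) : semi (-t) = semi t := by simp [semi]

lemma slope_neg (t : ℝ) : slope (-t) = -slope t := by
  simp [slope, semi_neg]; ring

lemma profile_neg (t : ℝ) : profile (-t) = profile t := by
  simp [profile, semi_neg]

lemma semi_eq_zero {t : ℝ} (ht : t ∉ B) : semi t = 0 := by
  unfold semi
  apply Real.sqrt_eq_zero_of_nonpos
  by_contra! h
  apply ht
  have : t ^ 2 < 1 := by linarith
  exact abs_lt.1 ((sq_lt_one_iff_abs_lt_one t).1 this)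

lemma one_sub_sq_pos {t : ℝ} (ht : t ∈ B) : 0 < 1 - t ^ 2 := by
  have := ht.1; have := ht.2; nlinarith

lemma semi_pos {t : ℝ} (ht : t ∈ B) : 0 < semi t := Real.sqrt_pos.2 (one_sub_sq_pos ht)

lemma semi_sq {t : ℝ} (ht : t ∈ B) : semi t ^ 2 = 1 - t ^ 2 :=
  Real.sq_sqrt (one_sub_sq_pos ht).le

lemma div_semi (t : ℝ) : (1 - t ^ 2) / semi t = semi t := Real.div_sqrt

/-- For `|t| > 1` the function is locally `0`, and so is the formula, by the convention `t / 0 = 0`.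
-/
lemma hasDerivAt_semi {t : ℝ} (h1 : t ≠ -1) (h2 : t ≠ 1) :
    HasDerivAt semi (-(t / semi t)) t := by
  have h0 : (1 - t ^ 2) ≠ 0 := by
    intro h
    have : (t + 1) * (t - 1) = 0 := by linarith
    rcases mul_eq_zero.1 this with h | h
    · exact h1 (by linarith)
    · exact h2 (by linarith)
  have := (Real.hasDerivAt_sqrt h0).comp t (((hasDerivAt_id t).pow 2).const_sub 1)
  refine this.congr_deriv ?_
  simp only [semi, id]
  by_cases hs : √(1 - t ^ 2) = 0
  · simp [hs]
  · field_simp; norm_num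

lemma ne_of_notMem_pair {t : ℝ} (ht : t ∉ ({-1, 1} : Set ℝ)) : t ≠ -1 ∧ t ≠ 1 := by
  simpa [not_or] using ht

lemma mem_compl_pair {t : ℝ} (ht : t ∈ B) : t ∉ ({-1, 1} : Set ℝ) := by
  have := ht.1; have := ht.2
  simp only [Set.mem_insert_iff, Set.mem_singleton_iff, not_or]
  constructor <;> intro h <;> linarith

lemma countable_pair : ({-1, 1} : Set ℝ).Countable := (Set.toFinite _).countable

/-- The summands are not differentiable at `±1`, but both sides are continuous, so the identity
extends there. Outside `B` the function is constant, `-π/4` on the right and `π/4` on the left. -/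
lemma hasDerivAt_slope (t : ℝ) : HasDerivAt slope (-semi t) t := by
  refine hasDerivAt_of_off_countable (g := fun t => -semi t) isOpen_univ Set.ordConnected_univ
    countable_pair
    continuous_slope.continuousOn continuous_semi.neg.continuousOn ?_ (Set.mem_univ t)
  intro t _ ht
  obtain ⟨h1, h2⟩ := ne_of_notMem_pair ht
  have := ((((hasDerivAt_id t).mul (hasDerivAt_semi h1 h2)).add
    (Real.hasDerivAt_arcsin h1 h2)).neg).div_const 2
  refine this.congr_deriv ?_
  have h3 := div_semi t
  simp only [id] at *
  change -(1 * semi t + t * -(t / semi t) + 1 / semi t) / 2 = _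
  have : t * -(t / semi t) + 1 / semi t = semi t := by
    conv_rhs => rw [← h3]
    ring
  linarith

lemma hasDerivAt_profile (t : ℝ) : HasDerivAt profile (slope t) t := by
  refine hasDerivAt_of_off_countable isOpen_univ Set.ordConnected_univ countable_pair
    continuous_profile.continuousOn continuous_slope.continuousOn ?_ (Set.mem_univ t)
  intro t _ ht
  obtain ⟨h1, h2⟩ := ne_of_notMem_pair ht
  have := ((((hasDerivAt_semi h1 h2).pow 3).div_const 6).sub
    ((((hasDerivAt_id t).mul (Real.hasDerivAt_arcsin h1 h2)).add
      (hasDerivAt_semi h1 h2)).div_const 2)).add_const (Real.pi / 4)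
  refine this.congr_deriv ?_
  have h3 : semi t ^ 2 * (t / semi t) = semi t * t := by
    by_cases hs : semi t = 0
    · simp [hs]
    · field_simp
  simp only [id, slope]
  change _ - (1 * Real.arcsin t + t * (1 / semi t) + -(t / semi t)) / 2 = _
  push_cast
  norm_num
  linear_combination -(1 / 2) * h3

lemma abs_slope_le (t : ℝ) : |slope t| ≤ 2 := by
  have h1 := Real.arcsin_le_pi_div_two t
  have h2 := Real.neg_pi_div_two_le_arcsin t
  have h3 := Real.pi_lt_four
  have h4 : |t * semi t| ≤ 1 := by
    by_cases ht : t ∈ B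
    · rw [abs_mul, abs_of_nonneg (semi_nonneg t)]
      exact mul_le_one₀ (abs_lt.2 ht).le (semi_nonneg t) (semi_le_one t)
    · simp [semi_eq_zero ht]
  obtain ⟨h5, h6⟩ := abs_le.1 h4
  rw [slope, abs_le]
  constructor <;> linarith

lemma profile_one : profile 1 = 0 := by simp [profile, semi]; ring

lemma profile_neg_one : profile (-1) = 0 := by rw [profile_neg, profile_one]

lemma abs_profile_sub_le (s t : ℝ) : |profile t - profile s| ≤ 2 * |t - s| := by
  have := Convex.norm_image_sub_le_of_norm_hasDerivWithin_le (s := Set.univ) (C := 2)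
    (fun x _ => (hasDerivAt_profile x).hasDerivWithinAt) (fun x _ => abs_slope_le x) convex_univ
    (Set.mem_univ s) (Set.mem_univ t)
  simpa using this

lemma hasDerivAt_neg_div_semi {t : ℝ} (ht : t ∈ B) :
    HasDerivAt (fun t => -(t / semi t)) (-(1 / semi t ^ 3)) t := by
  obtain ⟨h1, h2⟩ := ne_of_notMem_pair (mem_compl_pair ht)
  have hp := (semi_pos ht).ne'
  refine (((hasDerivAt_id t).div (hasDerivAt_semi h1 h2) hp).neg).congr_deriv ?_
  have := semi_sq ht
  simp only [id]
  field_simp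
  linear_combination -this

/-! ### The logarithmic kernel -/

/-- The kernel `arsinh √(ρ(x, t))`, which is `π` times the Green function of `(-Δ)^{1/2}`. -/
noncomputable def logKer (x t : ℝ) : ℝ := Real.arsinh (semi x * semi t / |x - t|)

lemma logKer_nonneg (x t : ℝ) : 0 ≤ logKer x t :=
  Real.arsinh_nonneg_iff.2 (div_nonneg (mul_nonneg (semi_nonneg _) (semi_nonneg _)) (abs_nonneg _))

lemma logKer_eq_zero {x t : ℝ} (ht : t ∉ B) : logKer x t = 0 := by
  simp [logKer, semi_eq_zero ht]

lemma one_sub_mul_pos {x t : ℝ} (hx : x ∈ B) (ht : t ∈ B) : 0 < 1 - x * t := by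
  have := hx.1; have := hx.2; have := ht.1; have := ht.2; nlinarith

/-- Rests on `(x - t)² + (1 - x²)(1 - t²) = (1 - xt)²`, which evaluates the root in `arsinh z = log
(z + √(1 + z²))`. `Real.log (t - x)` is `log |t - x|`, so both sides of `x` are covered. -/
lemma logKer_eq_log {x t : ℝ} (hx : x ∈ B) (ht : t ∈ B) (hxt : t ≠ x) :
    logKer x t = Real.log (1 - x * t + semi x * semi t) - Real.log (t - x) := by
  have hp : 0 < |x - t| := abs_pos.2 (sub_ne_zero.2 hxt.symm)
  have h1 := one_sub_mul_pos hx ht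
  have h2 : √(1 + (semi x * semi t / |x - t|) ^ 2) = (1 - x * t) / |x - t| := by
    rw [Real.sqrt_eq_iff_mul_self_eq (by positivity) (by positivity)]
    have e1 := semi_sq hx
    have e2 := semi_sq ht
    rw [div_mul_div_comm, div_pow, mul_pow, e1, e2, ← sq |x - t|, sq_abs]
    have : (x - t) ^ 2 ≠ 0 := pow_ne_zero _ (sub_ne_zero.2 hxt.symm)
    field_simp
    ring
  have h3 := semi_pos hx
  have h4 := semi_pos ht
  rw [logKer, Real.arsinh, h2, ← add_div, Real.log_div (by positivity) hp.ne', Real.log_abs,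
    ← neg_sub t x, Real.log_neg_eq_log]
  congr 2
  ring

lemma hasDerivAt_logKer {x t : ℝ} (hx : x ∈ B) (ht : t ∉ ({-1, 1} : Set ℝ)) (hxt : t ≠ x) :
    HasDerivAt (logKer x) (-(semi x / ((t - x) * semi t))) t := by
  obtain ⟨h1, h2⟩ := ne_of_notMem_pair ht
  by_cases hB : t ∈ B
  · have hev : logKer x =ᶠ[nhds t]
        fun t => Real.log (1 - x * t + semi x * semi t) - Real.log (t - x) := by
      filter_upwards [isOpen_Ioo.mem_nhds hB, isOpen_ne.mem_nhds hxt] with u hu hux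
      exact logKer_eq_log hx hu hux
    have p1 := one_sub_mul_pos hx hB
    have p2 := semi_pos hx
    have p3 := semi_pos hB
    have p4 : t - x ≠ 0 := sub_ne_zero.2 hxt
    have d1 : HasDerivAt (fun t => 1 - x * t + semi x * semi t)
        (-x + semi x * (-(t / semi t))) t := by
      refine ((((hasDerivAt_id t).const_mul x).const_sub 1).add
        ((hasDerivAt_semi h1 h2).const_mul (semi x))).congr_deriv (by simp)
    have p5 : 0 < 1 - x * t + semi x * semi t := by positivity
    have d2 := (d1.log p5.ne').sub (((hasDerivAt_id t).sub_const x).log p4)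
    refine (d2.congr_of_eventuallyEq hev).congr_deriv ?_
    have e1 := semi_sq hx
    have e2 := semi_sq hB
    simp only [id]
    field_simp
    linear_combination (-semi x) * e2 + semi t * e1
  · have hev : logKer x =ᶠ[nhds t] fun _ => 0 := by
      have : (Set.Icc (-1 : ℝ) 1)ᶜ ∈ nhds t := by
        refine isClosed_Icc.isOpen_compl.mem_nhds ?_
        rintro ⟨a, b⟩
        exact hB ⟨lt_of_le_of_ne a h1.symm, lt_of_le_of_ne b h2⟩
      filter_upwards [this] with u hu
      exact logKer_eq_zero fun h => hu (Set.Ioo_subset_Icc_self h)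
    refine ((hasDerivAt_const t (0 : ℝ)).congr_of_eventuallyEq hev).congr_deriv ?_
    simp [semi_eq_zero hB]

lemma continuousAt_logKer {x t : ℝ} (hxt : t ≠ x) : ContinuousAt (logKer x) t := by
  have : |x - t| ≠ 0 := abs_ne_zero.2 (sub_ne_zero.2 hxt.symm)
  have := continuous_semi.continuousAt (x := t)
  unfold logKer
  exact Real.continuous_arsinh.continuousAt.comp
    ((continuousAt_const.mul this).div (by fun_prop) ‹_›)

/-! ### Boggio's formula for `s = 1/2` and `s = 1` -/

lemma delta_eq (t : ℝ) : delta t = semi t ^ 2 := by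
  unfold delta semi
  rw [sq_abs]
  split_ifs with h
  · rw [Real.sq_sqrt h.le]
  · rw [Real.sqrt_eq_zero_of_nonpos (not_lt.1 h)]; simp

lemma sqrt_rho (x y : ℝ) : √(rho x y) = semi x * semi y / |x - y| := by
  rw [rho, delta_eq, delta_eq, ← mul_pow, ← div_pow, Real.sqrt_sq]
  exact div_nonneg (mul_nonneg (semi_nonneg _) (semi_nonneg _)) (abs_nonneg _)

lemma rho_nonneg (x y : ℝ) : 0 ≤ rho x y := by
  rw [rho, delta_eq, delta_eq]; positivity

lemma omega_one : omega 1 = 2 := by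
  have : √Real.pi ≠ 0 := (Real.sqrt_pos.2 Real.pi_pos).ne'
  rw [omega, Nat.cast_one, Real.Gamma_one_half_eq, ← Real.sqrt_eq_rpow]
  field_simp

lemma integral_half (r : ℝ) (hr : 0 ≤ r) :
    ∫ t in (0 : ℝ)..r, t ^ ((1 / 2 : ℝ) - 1) / (t + 1) ^ ((1 : ℝ) / 2) =
      2 * Real.arsinh (√r) := by
  have hc : ContinuousOn (fun t => 2 * Real.arsinh (√t)) (Set.Icc 0 r) := by
    have := Real.continuous_arsinh
    fun_prop
  have hd : ∀ t ∈ Set.Ioo 0 r, HasDerivAt (fun t => 2 * Real.arsinh (√t))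
      (t ^ ((1 / 2 : ℝ) - 1) / (t + 1) ^ ((1 : ℝ) / 2)) t := by
    intro t ht
    have h0 := ht.1
    refine (((Real.hasDerivAt_arsinh _).comp t
      (Real.hasDerivAt_sqrt h0.ne')).const_mul 2).congr_deriv ?_
    rw [Real.sq_sqrt h0.le, ← Real.sqrt_eq_rpow, show (1 / 2 : ℝ) - 1 = -(1 / 2) by norm_num,
      Real.rpow_neg h0.le, ← Real.sqrt_eq_rpow, add_comm 1 t]
    have := Real.sqrt_pos.2 h0
    have := Real.sqrt_pos.2 (show 0 < t + 1 by linarith)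
    field_simp
  rw [intervalIntegral.integral_eq_sub_of_hasDerivAt_of_le hr hc hd]
  · simp
  · rw [intervalIntegrable_iff_integrableOn_Ioc_of_le hr]
    -- The integrand is unbounded at `0`; a nonnegative derivative of a continuous function is
    -- integrable.
    refine intervalIntegral.integrableOn_deriv_of_nonneg hc hd fun t ht => ?_
    have := ht.1
    positivity

lemma integral_one (r : ℝ) (hr : 0 ≤ r) :
    ∫ t in (0 : ℝ)..r, t ^ ((1 : ℝ) - 1) / (t + 1) ^ ((1 : ℝ) / 2) = 2 * (√(r + 1) - 1) := by
  have hd : ∀ t ∈ Set.uIcc 0 r, HasDerivAt (fun t => 2 * √(t + 1))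
      (t ^ ((1 : ℝ) - 1) / (t + 1) ^ ((1 : ℝ) / 2)) t := by
    intro t ht
    rw [Set.uIcc_of_le hr] at ht
    have h0 : 0 < t + 1 := by linarith [ht.1]
    refine (((Real.hasDerivAt_sqrt h0.ne').comp t
      ((hasDerivAt_id t).add_const 1)).const_mul 2).congr_deriv ?_
    have := Real.sqrt_pos.2 h0
    rw [← Real.sqrt_eq_rpow, sub_self, Real.rpow_zero]
    field_simp
  rw [intervalIntegral.integral_eq_sub_of_hasDerivAt hd]
  · simp; ring
  · apply ContinuousOn.intervalIntegrable
    rw [Set.uIcc_of_le hr]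
    simp only [sub_self, Real.rpow_zero]
    refine continuousOn_const.div (ContinuousOn.rpow_const (by fun_prop) ?_) ?_
    · intro t ht; left; linarith [ht.1]
    · intro t ht
      have := ht.1
      positivity

lemma green_half (x y : ℝ) : green (1 / 2) x y = Real.pi⁻¹ * logKer x y := by
  rw [green, integral_half _ (rho_nonneg x y), sqrt_rho, boggioConst, omega_one,
    Real.Gamma_one_half_eq, Real.sq_sqrt Real.pi_pos.le, logKer]
  norm_num
  ring

lemma green_one {x y : ℝ} (hx : x ∈ B) (hy : y ∈ B) (hxy : y ≠ x) :
    green 1 x y = (1 - x * y - |x - y|) / 2 := by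
  have hp : 0 < |x - y| := abs_pos.2 (sub_ne_zero.2 hxy.symm)
  have h1 := one_sub_mul_pos hx hy
  have h2 : √(rho x y + 1) = (1 - x * y) / |x - y| := by
    rw [Real.sqrt_eq_iff_mul_self_eq (by linarith [rho_nonneg x y]) (by positivity), rho, delta_eq,
      delta_eq, semi_sq hx, semi_sq hy, div_mul_div_comm, ← sq |x - y|, sq_abs]
    have : (x - y) ^ 2 ≠ 0 := pow_ne_zero _ (sub_ne_zero.2 hxy.symm)
    field_simp
    ring
  rw [green, integral_one _ (rho_nonneg x y), h2, boggioConst, omega_one, Real.Gamma_one,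
    show (1 : ℝ) - 2 * 1 = -1 by norm_num, show (2 : ℝ) * 1 - 1 = 1 by norm_num, Real.rpow_one,
    Real.rpow_neg_one]
  field_simp

lemma green_eq_zero (s : ℝ) {x : ℝ} (hx : x ∉ B) (y : ℝ) : green s x y = 0 := by
  simp [green, rho, delta_eq, semi_eq_zero hx]

/-! ### Closed form of `w₁` -/

/-- The antiderivative of `logKer x`. -/
noncomputable def logPrim (x t : ℝ) : ℝ := (t - x) * logKer x t + semi x * Real.arcsin t

/-- The factor `t - x` tames the logarithm at `x`, since `u log u` is continuous. -/
lemma continuous_logPrim {x : ℝ} (hx : x ∈ B) : Continuous (logPrim x) := by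
  rw [continuous_iff_continuousAt]
  intro t
  refine ContinuousAt.add ?_ (continuousAt_const.mul Real.continuous_arcsin.continuousAt)
  by_cases hxt : t = x
  · subst hxt
    have hev : (fun u => (u - t) * logKer t u) =ᶠ[nhds t] fun u =>
        (u - t) * Real.log (1 - t * u + semi t * semi u) - (u - t) * Real.log (u - t) := by
      filter_upwards [isOpen_Ioo.mem_nhds hx] with u hu
      by_cases h : u = t
      · simp [h]
      · rw [logKer_eq_log hx hu h]; ring
    refine ContinuousAt.congr ?_ hev.symm
    have h1 := continuous_semi
    have h2 := one_sub_mul_pos hx hx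
    have h3 := semi_nonneg t
    have h4 : 1 - t * t + semi t * semi t ≠ 0 := by positivity
    refine ContinuousAt.sub ?_ ?_
    · refine ContinuousAt.mul (by fun_prop) (ContinuousAt.log (by fun_prop) h4)
    · exact (Real.continuous_mul_log.comp (continuous_id.sub continuous_const)).continuousAt
  · exact (by fun_prop : ContinuousAt (fun u => u - x) t).mul (continuousAt_logKer hxt)

lemma hasDerivAt_logPrim {x t : ℝ} (hx : x ∈ B) (ht : t ∈ B) (hxt : t ≠ x) :
    HasDerivAt (logPrim x) (logKer x t) t := by
  obtain ⟨h1, h2⟩ := ne_of_notMem_pair (mem_compl_pair ht)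
  refine ((((hasDerivAt_id t).sub_const x).mul (hasDerivAt_logKer hx (mem_compl_pair ht) hxt)).add
    ((Real.hasDerivAt_arcsin h1 h2).const_mul (semi x))).congr_deriv ?_
  have p4 : t - x ≠ 0 := sub_ne_zero.2 hxt
  have := semi_pos ht
  change 1 * logKer x t + (t - x) * _ + semi x * (1 / semi t) = _
  field_simp
  ring

/-- The singularity `x` is kept out of the open interval; integrals over `B` are split there. -/
lemma integral_logKer_of_le {x a b : ℝ} (hx : x ∈ B) (ha : -1 ≤ a) (hb : b ≤ 1) (hab : a ≤ b)
    (h : x ≤ a ∨ b ≤ x) :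
    IntervalIntegrable (logKer x) volume a b ∧
      ∫ t in a..b, logKer x t = logPrim x b - logPrim x a := by
  have hd : ∀ t ∈ Set.Ioo a b, HasDerivAt (logPrim x) (logKer x t) t := by
    intro t ht
    refine hasDerivAt_logPrim hx ⟨ha.trans_lt ht.1, ht.2.trans_le hb⟩ ?_
    rintro rfl
    rcases h with h | h
    · exact absurd ht.1 (not_lt.2 h)
    · exact absurd ht.2 (not_lt.2 h)
  have hi : IntervalIntegrable (logKer x) volume a b := by
    rw [intervalIntegrable_iff_integrableOn_Ioc_of_le hab]
    exact intervalIntegral.integrableOn_deriv_of_nonneg (continuous_logPrim hx).continuousOn hd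
      fun t _ => logKer_nonneg x t
  exact ⟨hi, intervalIntegral.integral_eq_sub_of_hasDerivAt_of_le hab
    (continuous_logPrim hx).continuousOn hd hi⟩

lemma integral_B (f : ℝ → ℝ) : ∫ t in B, f t = ∫ t in (-1 : ℝ)..1, f t := by
  rw [intervalIntegral.integral_of_le (by norm_num), integral_Ioc_eq_integral_Ioo, B]

lemma integrableOn_B {f : ℝ → ℝ} : IntegrableOn f B ↔ IntervalIntegrable f volume (-1) 1 := by
  rw [intervalIntegrable_iff_integrableOn_Ioc_of_le (by norm_num), integrableOn_Ioc_iff_integrableOn_Ioo, B]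

lemma integrableOn_logKer {x : ℝ} (hx : x ∈ B) : IntegrableOn (logKer x) B := by
  rw [integrableOn_B]
  exact (integral_logKer_of_le hx le_rfl hx.2.le hx.1.le (Or.inr le_rfl)).1.trans
    (integral_logKer_of_le hx hx.1.le le_rfl hx.2.le (Or.inl le_rfl)).1

lemma integral_logKer {x : ℝ} (hx : x ∈ B) : ∫ t in B, logKer x t = Real.pi * semi x := by
  obtain ⟨i1, e1⟩ := integral_logKer_of_le hx le_rfl hx.2.le hx.1.le (Or.inr le_rfl)
  obtain ⟨i2, e2⟩ := integral_logKer_of_le hx hx.1.le le_rfl hx.2.le (Or.inl le_rfl)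
  have h1 : logKer x 1 = 0 := logKer_eq_zero (by simp [B])
  have h2 : logKer x (-1) = 0 := logKer_eq_zero (by simp [B])
  rw [integral_B, ← intervalIntegral.integral_add_adjacent_intervals i1 i2, e1, e2]
  simp only [logPrim, h1, h2, Real.arcsin_one, Real.arcsin_neg_one]
  ring

lemma integrableOn_green_half (z : ℝ) : IntegrableOn (fun y => green (1 / 2) z y) B := by
  by_cases hz : z ∈ B
  · simp only [green_half]
    exact (integrableOn_logKer hz).const_mul _
  · simp only [green_eq_zero _ hz]
    exact integrableOn_zero

lemma w₁_eq (z : ℝ) : w₁ z = semi z := by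
  rw [w₁]
  by_cases hz : z ∈ B
  · simp only [green_half]
    rw [integral_const_mul, integral_logKer hz, inv_mul_cancel_left₀ Real.pi_ne_zero]
  · simp [green_eq_zero _ hz, semi_eq_zero hz]

/-! ### Closed form of `w` -/

lemma green_one_mul_w₁_ae {x : ℝ} (hx : x ∈ B) :
    (fun z => green 1 x z * w₁ z) =ᵐ[volume.restrict B]
      fun z => (1 - x * z - |x - z|) / 2 * semi z := by
  have h : ∀ᵐ z : ℝ, z ≠ x := by simp [ae_iff]
  rw [Filter.EventuallyEq, ae_restrict_iff' (by exact measurableSet_Ioo)]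
  filter_upwards [h] with z hz hzB
  rw [green_one hx hzB hz, w₁_eq]

lemma integrableOn_green_one (x : ℝ) : IntegrableOn (fun z => green 1 x z * w₁ z) B := by
  by_cases hx : x ∈ B
  · refine IntegrableOn.congr_fun_ae ?_ (green_one_mul_w₁_ae hx).symm
    rw [integrableOn_B]
    have := continuous_semi
    exact Continuous.intervalIntegrable (by fun_prop) _ _
  · simp only [green_eq_zero _ hx, zero_mul]
    exact integrableOn_zero

lemma hasDerivAt_semi_cube {t : ℝ} (ht : t ∈ B) :
    HasDerivAt (fun t => semi t ^ 3) (-(3 * t * semi t)) t := by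
  obtain ⟨h1, h2⟩ := ne_of_notMem_pair (mem_compl_pair ht)
  refine ((hasDerivAt_semi h1 h2).pow 3).congr_deriv ?_
  have := semi_pos ht
  push_cast
  field_simp

/-- The kernel factors as `(1 - x)(1 + z)/2` for `z < x` and `(1 + x)(1 - z)/2` for `z > x`, while
`semi z` and `z * semi z` have antiderivatives `-slope z` and `-semi z ^ 3 / 3`. -/
lemma w_eq_profile {x : ℝ} (hx : x ∈ B) : w x = profile x := by
  have hs := continuous_semi
  have hsl := continuous_slope
  rw [w, integral_congr_ae (green_one_mul_w₁_ae hx), integral_B]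
  have c1 : Continuous fun z => (1 - x * z - |x - z|) / 2 * semi z := by fun_prop
  rw [← intervalIntegral.integral_add_adjacent_intervals (c1.intervalIntegrable (-1) x)
    (c1.intervalIntegrable x 1)]
  have e1 : ∫ z in (-1 : ℝ)..x, (1 - x * z - |x - z|) / 2 * semi z =
      (1 - x) / 2 * (-semi x ^ 3 / 3 - slope x) - (1 - x) / 2 * (-semi (-1) ^ 3 / 3 - slope (-1)) := by
    refine intervalIntegral.integral_eq_sub_of_hasDerivAt_of_le
      (f := fun z => (1 - x) / 2 * (-semi z ^ 3 / 3 - slope z)) hx.1.le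
      (Continuous.continuousOn (by fun_prop)) ?_ (c1.intervalIntegrable _ _)
    intro z hz
    refine (((((hasDerivAt_semi_cube ⟨hz.1, hz.2.trans hx.2⟩).neg).div_const 3).sub
      (hasDerivAt_slope z)).const_mul ((1 - x) / 2)).congr_deriv ?_
    rw [abs_of_pos (sub_pos.2 hz.2)]
    ring
  have e2 : ∫ z in x..1, (1 - x * z - |x - z|) / 2 * semi z =
      (1 + x) / 2 * (semi 1 ^ 3 / 3 - slope 1) - (1 + x) / 2 * (semi x ^ 3 / 3 - slope x) := by
    refine intervalIntegral.integral_eq_sub_of_hasDerivAt_of_le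
      (f := fun z => (1 + x) / 2 * (semi z ^ 3 / 3 - slope z)) hx.2.le
      (Continuous.continuousOn (by fun_prop)) ?_ (c1.intervalIntegrable _ _)
    intro z hz
    refine ((((hasDerivAt_semi_cube ⟨hx.1.trans hz.1, hz.2⟩).div_const 3).sub
      (hasDerivAt_slope z)).const_mul ((1 + x) / 2)).congr_deriv ?_
    rw [abs_of_neg (sub_neg.2 hz.1)]
    ring
  have hx2 := semi_sq hx
  rw [e1, e2, slope_neg, semi_neg]
  simp only [slope, profile, show semi 1 = 0 by simp [semi], Real.arcsin_one]
  linear_combination (-semi x / 2) * hx2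

lemma w_eq_zero {x : ℝ} (hx : x ∉ B) : w x = 0 := by
  simp [w, green_eq_zero _ hx]

/-- Since `profile` vanishes at `±1`, clamping replaces the case distinction; continuity and the
global Lipschitz bound follow at once. -/
lemma w_eq_profile_clamp (t : ℝ) : w t = profile (max (-1) (min t 1)) := by
  by_cases ht : t ∈ B
  · rw [w_eq_profile ht, min_eq_left ht.2.le, max_eq_right ht.1.le]
  · rw [w_eq_zero ht]
    rcases le_or_gt t (-1) with h | h
    · rw [min_eq_left (by linarith), max_eq_left h, profile_neg_one]
    · have : 1 ≤ t := by
        by_contra! h2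
        exact ht ⟨h, h2⟩
      rw [min_eq_right this, max_eq_right (by norm_num), profile_one]

lemma abs_w_sub_le (s t : ℝ) : |w t - w s| ≤ 2 * |t - s| := by
  rw [w_eq_profile_clamp, w_eq_profile_clamp]
  refine (abs_profile_sub_le _ _).trans ?_
  have h1 := abs_max_sub_max_le_abs (min t 1) (min s 1) (-1)
  have h2 := abs_min_sub_min_le_max t 1 s 1
  simp only [sub_self, abs_zero, max_eq_left (abs_nonneg (t - s))] at h2
  rw [max_comm (-1), max_comm (-1)]
  linarith

lemma continuous_w : Continuous w := by
  have h := continuous_profile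
  have : w = fun t => profile (max (-1) (min t 1)) := funext w_eq_profile_clamp
  rw [this]
  fun_prop

lemma w_neg (t : ℝ) : w (-t) = w t := by
  have hB : -t ∈ B ↔ t ∈ B := by
    simp only [B, Set.mem_Ioo]
    constructor <;> rintro ⟨a, b⟩ <;> constructor <;> linarith
  by_cases ht : t ∈ B
  · rw [w_eq_profile ht, w_eq_profile (hB.2 ht), profile_neg]
  · rw [w_eq_zero ht, w_eq_zero (mt hB.1 ht)]

lemma abs_w_le (t : ℝ) : |w t| ≤ 4 := by
  by_cases ht : t ∈ B
  · rw [w_eq_profile ht]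
    have := abs_profile_sub_le 1 t
    rw [profile_one, sub_zero] at this
    have h2 : |t - 1| ≤ 2 := by rw [abs_le]; constructor <;> linarith [ht.1, ht.2]
    linarith
  · simp [w_eq_zero ht]

/-! ### Derivatives and regularity of `w` off `±1` -/

/-- The derivative of `w` off `±1`. -/
noncomputable def wDeriv (t : ℝ) : ℝ := B.indicator slope t

lemma isOpen_B : IsOpen B := isOpen_Ioo

lemma wDeriv_eq {t : ℝ} (ht : t ∈ B) : wDeriv t = slope t := Set.indicator_of_mem ht _

lemma wDeriv_eq_zero {t : ℝ} (ht : t ∉ B) : wDeriv t = 0 := Set.indicator_of_notMem ht _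

lemma measurable_wDeriv : Measurable wDeriv :=
  continuous_slope.measurable.indicator isOpen_B.measurableSet

lemma eventually_notMem_B {t : ℝ} (ht : t ∉ B) (h : t ∉ ({-1, 1} : Set ℝ)) :
    ∀ᶠ u in nhds t, u ∉ B := by
  obtain ⟨h1, h2⟩ := ne_of_notMem_pair h
  have : (Set.Icc (-1 : ℝ) 1)ᶜ ∈ nhds t := by
    refine isClosed_Icc.isOpen_compl.mem_nhds ?_
    rintro ⟨a, b⟩
    exact ht ⟨lt_of_le_of_ne a h1.symm, lt_of_le_of_ne b h2⟩
  filter_upwards [this] with u hu h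
  exact hu (Set.Ioo_subset_Icc_self h)

lemma hasDerivAt_w {t : ℝ} (h : t ∉ ({-1, 1} : Set ℝ)) : HasDerivAt w (wDeriv t) t := by
  by_cases ht : t ∈ B
  · rw [wDeriv_eq ht]
    refine (hasDerivAt_profile t).congr_of_eventuallyEq ?_
    filter_upwards [isOpen_B.mem_nhds ht] with u hu using w_eq_profile hu
  · rw [wDeriv_eq_zero ht]
    refine (hasDerivAt_const t (0 : ℝ)).congr_of_eventuallyEq ?_
    filter_upwards [eventually_notMem_B ht h] with u hu using w_eq_zero hu

lemma hasDerivAt_wDeriv {t : ℝ} (h : t ∉ ({-1, 1} : Set ℝ)) : HasDerivAt wDeriv (-semi t) t := by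
  by_cases ht : t ∈ B
  · refine (hasDerivAt_slope t).congr_of_eventuallyEq ?_
    filter_upwards [isOpen_B.mem_nhds ht] with u hu using wDeriv_eq hu
  · rw [semi_eq_zero ht, neg_zero]
    refine (hasDerivAt_const t (0 : ℝ)).congr_of_eventuallyEq ?_
    filter_upwards [eventually_notMem_B ht h] with u hu using wDeriv_eq_zero hu

lemma isOpen_compl_pair : IsOpen ({-1, 1}ᶜ : Set ℝ) := (Set.toFinite _).isClosed.isOpen_compl

lemma laplacian_w {t : ℝ} (h : t ∉ ({-1, 1} : Set ℝ)) : (Δ w) t = -semi t := by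
  rw [InnerProductSpace.laplacian_eq_iteratedDeriv_real, iteratedDeriv_succ, iteratedDeriv_one]
  have : deriv w =ᶠ[nhds t] wDeriv := by
    filter_upwards [isOpen_compl_pair.mem_nhds h] with u hu using (hasDerivAt_w hu).deriv
  rw [this.deriv_eq, (hasDerivAt_wDeriv h).deriv]

lemma contDiffAt_profile {t : ℝ} (ht : t ∈ B) : ContDiffAt ℝ ∞ profile t := by
  obtain ⟨h1, h2⟩ := ne_of_notMem_pair (mem_compl_pair ht)
  have h3 : ContDiffAt ℝ ∞ semi t :=
    ContDiffAt.sqrt (contDiffAt_const.sub (contDiffAt_id.pow 2)) (one_sub_sq_pos ht).ne'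
  have h4 : ContDiffAt ℝ ∞ Real.arcsin t := Real.contDiffAt_arcsin h1 h2
  unfold profile
  fun_prop

lemma contDiffOn_w : ContDiffOn ℝ ∞ w {-1, 1}ᶜ := by
  intro t h
  refine ContDiffAt.contDiffWithinAt ?_
  by_cases ht : t ∈ B
  · refine (contDiffAt_profile ht).congr_of_eventuallyEq ?_
    filter_upwards [isOpen_B.mem_nhds ht] with u hu using w_eq_profile hu
  · refine (contDiffAt_const (c := (0 : ℝ))).congr_of_eventuallyEq ?_
    filter_upwards [eventually_notMem_B ht h] with u hu using w_eq_zero hu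

lemma memWeightedL1_w : MemWeightedL1 (1 / 2) w := by
  refine ⟨continuous_w.locallyIntegrable, ?_⟩
  have h1 : HasCompactSupport fun x : ℝ => |w x| / (1 + |x| ^ (1 + 2 * (1 / 2 : ℝ))) := by
    refine HasCompactSupport.intro (isCompact_Icc (a := (-1 : ℝ)) (b := 1)) fun x hx => ?_
    rw [w_eq_zero fun h => hx (Set.Ioo_subset_Icc_self h)]
    simp
  refine Continuous.integrable_of_hasCompactSupport ?_ h1
  have := continuous_w
  refine this.abs.div (continuous_const.add (Continuous.rpow_const continuous_abs ?_)) ?_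
  · intro x; right; norm_num
  · intro x; positivity

/-! ### Finite differences and absolute convergence -/

/-- A second difference is bounded by the second derivative. -/
lemma abs_second_diff_le {u u' u'' : ℝ → ℝ} {M x y : ℝ}
    (h1 : ∀ t, |t - x| ≤ |y| → HasDerivAt u (u' t) t)
    (h2 : ∀ t, |t - x| ≤ |y| → HasDerivAt u' (u'' t) t)
    (h3 : ∀ t, |t - x| ≤ |y| → |u'' t| ≤ M) :
    |2 * u x - u (x + y) - u (x - y)| ≤ M * y ^ 2 := by
  wlog hy : 0 ≤ y generalizing y
  · have := this (y := -y) (by simpa using h1) (by simpa using h2) (by simpa using h3)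
      (by linarith)
    rw [sub_neg_eq_add, ← sub_eq_add_neg, neg_sq] at this
    convert this using 2
    ring
  rw [abs_of_nonneg hy] at *
  have hin : ∀ s ∈ Set.Icc 0 y, |x + s - x| ≤ y ∧ |x - s - x| ≤ y := by
    intro s hs
    rw [show x + s - x = s by ring, show x - s - x = -s by ring, abs_neg, abs_of_nonneg hs.1]
    exact ⟨hs.2, hs.2⟩
  have hd : ∀ s ∈ Set.Icc 0 y, HasDerivAt (fun s => 2 * u x - u (x + s) - u (x - s))
      (-u' (x + s) + u' (x - s)) s := by
    intro s hs
    obtain ⟨a, b⟩ := hin s hs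
    have d1 := (h1 _ a).comp_const_add x s
    have d2 := (h1 _ b).comp_const_sub x s
    refine ((d1.const_sub (2 * u x)).sub d2).congr_deriv (by ring)
  -- The difference, as a function of the step `s`, has derivative `u' (x - s) - u' (x + s)`, at
  -- most `2 * s * M` in absolute value; it is compared with `M * s ^ 2`.
  have key := image_norm_le_of_norm_deriv_right_le_deriv_boundary
    (f := fun s => 2 * u x - u (x + s) - u (x - s)) (a := 0) (b := y)
    (f' := fun s => -u' (x + s) + u' (x - s)) (B := fun s => M * s ^ 2)
    (B' := fun s => M * (2 * s))
    (fun s hs => (hd s hs).continuousAt.continuousWithinAt)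
    (fun s hs => (hd s (Set.Ico_subset_Icc_self hs)).hasDerivWithinAt)
    (by simp; ring_nf)
    (fun s => by simpa using ((hasDerivAt_id s).pow 2).const_mul M)
    (fun s hs => by
      have h0 := hs.1
      have := Convex.norm_image_sub_le_of_norm_hasDerivWithin_le (f := u') (f' := u'')
        (s := Metric.closedBall x y) (C := M) (x := x + s) (y := x - s)
        (fun t ht => (h2 t (by simpa [Real.dist_eq] using ht)).hasDerivWithinAt)
        (fun t ht => h3 t (by simpa [Real.dist_eq] using ht)) (convex_closedBall x y)
        (by simpa [Real.dist_eq] using (hin s (Set.Ico_subset_Icc_self hs)).1)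
        (by simpa [Real.dist_eq] using (hin s (Set.Ico_subset_Icc_self hs)).2)
      rw [show x - s - (x + s) = -(2 * s) by ring, norm_neg, Real.norm_eq_abs (2 * s),
        abs_of_nonneg (by positivity)] at this
      rwa [neg_add_eq_sub])
    (Set.right_mem_Icc.2 hy)
  exact key

/-- Turns distance to the boundary into a lower bound for `semi`, which controls the derivatives
that blow up at `±1`. -/
lemma one_sub_abs_le_semi (t : ℝ) : 1 - |t| ≤ semi t := by
  rcases le_or_gt 1 |t| with h | h
  · linarith [semi_nonneg t]
  · have h1 := semi_sq (t := t) (abs_lt.1 h)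
    have h2 := semi_nonneg t
    have h3 := semi_le_one t
    have h4 := abs_nonneg t
    rw [← sq_abs t] at h1
    nlinarith

lemma mem_B_iff {t : ℝ} : t ∈ B ↔ |t| < 1 := abs_lt.symm

lemma mem_B_of_abs_sub_le {x t e y : ℝ} (he : 0 < e) (hx : |x| + y + e ≤ 1) (ht : |t - x| ≤ y) :
    t ∈ B ∧ e ≤ semi t := by
  have h1 : |t| ≤ |t - x| + |x| := by simpa using abs_add_le (t - x) x
  exact ⟨mem_B_iff.2 (by linarith), by linarith [one_sub_abs_le_semi t]⟩

lemma abs_diff_profile_le (x y : ℝ) :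
    |2 * profile x - profile (x + y) - profile (x - y)| ≤ y ^ 2 := by
  have := abs_second_diff_le (u := profile) (x := x) (y := y) (M := 1)
    (fun t _ => hasDerivAt_profile t) (fun t _ => hasDerivAt_slope t)
    (fun t _ => by rw [abs_neg, abs_of_nonneg (semi_nonneg t)]; exact semi_le_one t)
  linarith

lemma abs_diff_slope_le {x y e : ℝ} (he : 0 < e) (h : |x| + |y| + e ≤ 1) :
    |2 * slope x - slope (x + y) - slope (x - y)| ≤ e⁻¹ * y ^ 2 := by
  refine abs_second_diff_le (u' := fun t => -semi t) (u'' := fun t => t / semi t)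
    (fun t _ => hasDerivAt_slope t) ?_ ?_
  · intro t ht
    have := (mem_B_of_abs_sub_le he h ht).1
    obtain ⟨h1, h2⟩ := ne_of_notMem_pair (mem_compl_pair this)
    exact (hasDerivAt_semi h1 h2).neg.congr_deriv (neg_neg _)
  · intro t ht
    obtain ⟨h1, h2⟩ := mem_B_of_abs_sub_le he h ht
    rw [abs_div, abs_of_nonneg (semi_nonneg t), ← one_div]
    exact div_le_div₀ zero_le_one (mem_B_iff.1 h1).le he h2

lemma abs_diff_semi_le {x y e : ℝ} (he : 0 < e) (h : |x| + |y| + e ≤ 1) :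
    |2 * semi x - semi (x + y) - semi (x - y)| ≤ (e ^ 3)⁻¹ * y ^ 2 := by
  refine abs_second_diff_le (u' := fun t => -(t / semi t)) (u'' := fun t => -(1 / semi t ^ 3))
    ?_ ?_ ?_
  · intro t ht
    have := (mem_B_of_abs_sub_le he h ht).1
    obtain ⟨h1, h2⟩ := ne_of_notMem_pair (mem_compl_pair this)
    exact hasDerivAt_semi h1 h2
  · intro t ht
    exact hasDerivAt_neg_div_semi (mem_B_of_abs_sub_le he h ht).1
  · intro t ht
    obtain ⟨h1, h2⟩ := mem_B_of_abs_sub_le he h ht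
    have := semi_nonneg t
    rw [abs_neg, abs_of_nonneg (by positivity), ← one_div]
    gcongr

/-- A fourth difference is a second difference of second differences, and the inner one has as
second derivative a second difference of `-semi`, already `O(y²)`. -/
lemma abs_fourth_diff_profile_le {x y e : ℝ} (he : 0 < e) (h : |x| + 2 * |y| + e ≤ 1) :
    |profile (x + 2 * y) - 4 * profile (x + y) + 6 * profile x - 4 * profile (x - y) +
      profile (x - 2 * y)| ≤ (e ^ 3)⁻¹ * y ^ 4 := by
  have key := abs_second_diff_le (x := x) (y := y) (M := (e ^ 3)⁻¹ * y ^ 2)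
    (u := fun z => 2 * profile z - profile (z + y) - profile (z - y))
    (u' := fun z => 2 * slope z - slope (z + y) - slope (z - y))
    (u'' := fun z => -(2 * semi z - semi (z + y) - semi (z - y)))
    (fun t _ => (((hasDerivAt_profile t).const_mul 2).sub
      ((hasDerivAt_profile (t + y)).comp_add_const t y)).sub
      ((hasDerivAt_profile (t - y)).comp_sub_const t y))
    (fun t _ => ((((hasDerivAt_slope t).const_mul 2).sub
      ((hasDerivAt_slope (t + y)).comp_add_const t y)).sub
      ((hasDerivAt_slope (t - y)).comp_sub_const t y)).congr_deriv (by ring))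
    (fun t ht => by
      rw [abs_neg]
      refine abs_diff_semi_le he ?_
      have h1 : |t| ≤ |t - x| + |x| := by simpa using abs_add_le (t - x) x
      linarith)
  rw [show (e ^ 3)⁻¹ * y ^ 4 = (e ^ 3)⁻¹ * y ^ 2 * y ^ 2 by ring]
  convert key using 2
  rw [show x + y + y = x + 2 * y by ring, show x + y - y = x by ring,
    show x - y + y = x by ring, show x - y - y = x - 2 * y by ring]
  ring

/-- A function that is bounded near `0` and `O(y⁻²)` elsewhere is `O((1 + y²)⁻¹)`. -/
lemma le_mul_inv_one_add_sq {e M K v y : ℝ} (he : 0 < e) (hM : 0 ≤ M) (hK : 0 ≤ K)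
    (h1 : |y| ≤ e → v ≤ M) (h2 : e < |y| → v ≤ K / y ^ 2) :
    v ≤ (M * (1 + e ^ 2) + K * (1 + 1 / e ^ 2)) * (1 + y ^ 2)⁻¹ := by
  have hp : 0 < 1 + y ^ 2 := by positivity
  rw [← div_eq_mul_inv, le_div_iff₀ hp]
  rcases le_or_gt |y| e with h | h
  · have h3 : y ^ 2 ≤ e ^ 2 := by rw [← sq_abs y]; gcongr
    have h4 : 0 ≤ K * (1 + 1 / e ^ 2) := by positivity
    calc v * (1 + y ^ 2) ≤ M * (1 + y ^ 2) := by gcongr; exact h1 h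
      _ ≤ M * (1 + e ^ 2) := by gcongr
      _ ≤ _ := by linarith
  · have h3 : e ^ 2 ≤ y ^ 2 := by rw [← sq_abs y]; gcongr
    have h5 : 0 < y ^ 2 := lt_of_lt_of_le (by positivity) h3
    have h4 : 0 ≤ M * (1 + e ^ 2) := by positivity
    calc v * (1 + y ^ 2) ≤ K / y ^ 2 * (1 + y ^ 2) := by gcongr; exact h2 h
      _ = K * (1 + 1 / y ^ 2) := by
        have : y ≠ 0 := by rintro rfl; simp at h5
        field_simp
        ring
      _ ≤ K * (1 + 1 / e ^ 2) := by gcongr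
      _ ≤ _ := by linarith

lemma integrable_of_le {f : ℝ → ℝ} {A : ℝ} (hf : AEStronglyMeasurable f)
    (h : ∀ y, |f y| ≤ A * (1 + y ^ 2)⁻¹) : Integrable f :=
  (integrable_inv_one_add_sq.const_mul A).mono' hf (Filter.Eventually.of_forall h)

lemma lowIntegrand_half (u : ℝ → ℝ) (x y : ℝ) :
    lowIntegrand (1 / 2) u x y = (2 * u x - u (x + y) - u (x - y)) / y ^ 2 := by
  rw [lowIntegrand, show (1 : ℝ) + 2 * (1 / 2) = (2 : ℕ) by norm_num, Real.rpow_natCast, sq_abs]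

lemma highIntegrand_three_halves (u : ℝ → ℝ) (x y : ℝ) :
    highIntegrand (3 / 2) u x y =
      (u (x + 2 * y) - 4 * u (x + y) + 6 * u x - 4 * u (x - y) + u (x - 2 * y)) / y ^ 4 := by
  rw [highIntegrand, show (1 : ℝ) + 2 * (3 / 2) = (4 : ℕ) by norm_num, Real.rpow_natCast,
    Even.pow_abs (by decide)]

lemma measurable_lowIntegrand {u : ℝ → ℝ} (hu : Measurable u) (x : ℝ) :
    Measurable (lowIntegrand (1 / 2) u x) := by
  rw [show lowIntegrand (1 / 2) u x = _ from funext (lowIntegrand_half u x)]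
  fun_prop

lemma integrable_lowIntegrand {u : ℝ → ℝ} {C M e x : ℝ} (hu : Measurable u)
    (hC : ∀ t, |u t| ≤ C) (he : 0 < e) (hM : 0 ≤ M)
    (h : ∀ y, |y| ≤ e → |2 * u x - u (x + y) - u (x - y)| ≤ M * y ^ 2) :
    Integrable (lowIntegrand (1 / 2) u x) := by
  have hC0 : 0 ≤ C := (abs_nonneg _).trans (hC 0)
  refine integrable_of_le (A := M * (1 + e ^ 2) + 4 * C * (1 + 1 / e ^ 2))
    (measurable_lowIntegrand hu x).aestronglyMeasurable fun y => ?_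
  rw [lowIntegrand_half, abs_div, abs_of_nonneg (sq_nonneg y)]
  refine le_mul_inv_one_add_sq he hM (by positivity) (fun hy => ?_) fun hy => ?_
  · exact div_le_of_le_mul₀ (sq_nonneg y) hM (h y hy)
  · gcongr
    have h1 := abs_le.1 (hC x)
    have h2 := abs_le.1 (hC (x + y))
    have h3 := abs_le.1 (hC (x - y))
    rw [abs_le]
    constructor <;> linarith

lemma integrable_lowIntegrand_w {x : ℝ} (hx : x ∈ B) :
    Integrable (lowIntegrand (1 / 2) w x) := by
  have hx1 := mem_B_iff.1 hx
  refine integrable_lowIntegrand (e := (1 - |x|) / 2) (M := 1) continuous_w.measurable abs_w_le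
    (by linarith) zero_le_one fun y hy => ?_
  have h1 : x + y ∈ B := (mem_B_of_abs_sub_le (y := |y|) (e := (1 - |x|) / 2) (x := x)
    (by linarith) (by linarith) (by simp)).1
  have h2 : x - y ∈ B := (mem_B_of_abs_sub_le (y := |y|) (e := (1 - |x|) / 2) (x := x)
    (by linarith) (by linarith) (by simp)).1
  rw [w_eq_profile hx, w_eq_profile h1, w_eq_profile h2, one_mul]
  exact abs_diff_profile_le x y

lemma abs_diff_wDeriv_le {x y e : ℝ} (he : 0 < e) (h : |x| + |y| + e ≤ 1) :
    |2 * wDeriv x - wDeriv (x + y) - wDeriv (x - y)| ≤ e⁻¹ * y ^ 2 := by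
  have h0 : x ∈ B := (mem_B_of_abs_sub_le (x := x) he h (by simp)).1
  have h1 : x + y ∈ B := (mem_B_of_abs_sub_le (x := x) he h (by simp)).1
  have h2 : x - y ∈ B := (mem_B_of_abs_sub_le (x := x) he h (by simp)).1
  rw [wDeriv_eq h0, wDeriv_eq h1, wDeriv_eq h2]
  exact abs_diff_slope_le he h

lemma integrable_lowIntegrand_slope {x : ℝ} (hx : x ∈ B) :
    Integrable (lowIntegrand (1 / 2) slope x) := by
  have hx1 := mem_B_iff.1 hx
  have he : 0 < (1 - |x|) / 2 := by linarith
  exact integrable_lowIntegrand continuous_slope.measurable abs_slope_le he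
    (inv_nonneg.2 he.le) fun y hy => abs_diff_slope_le he (by linarith)

lemma integrable_lowIntegrand_semi {x : ℝ} (hx : x ∈ B) :
    Integrable (lowIntegrand (1 / 2) semi x) := by
  have hx1 := mem_B_iff.1 hx
  have he : 0 < (1 - |x|) / 2 := by linarith
  exact integrable_lowIntegrand (C := 1) continuous_semi.measurable
    (fun t => by rw [abs_of_nonneg (semi_nonneg t)]; exact semi_le_one t) he
    (inv_nonneg.2 (pow_pos he 3).le) fun y hy => abs_diff_semi_le he (by linarith)

lemma integrable_highIntegrand_w {x : ℝ} (hx : x ∈ B) :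
    Integrable (highIntegrand (3 / 2) w x) := by
  have hx1 := mem_B_iff.1 hx
  have he : 0 < (1 - |x|) / 4 := by linarith
  set e := (1 - |x|) / 4 with hedef
  have hw := continuous_w.measurable
  -- `64 = 16 * 4`: the coefficients sum to `16` in absolute value and `|w| ≤ 4`; `1 / e ^ 2`
  -- absorbs two of the four powers of `y`.
  refine integrable_of_le
    (A := (e ^ 3)⁻¹ * (1 + e ^ 2) + 64 / e ^ 2 * (1 + 1 / e ^ 2)) ?_ fun y => ?_
  · rw [show highIntegrand (3 / 2) w x = _ from funext (highIntegrand_three_halves w x)]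
    exact Measurable.aestronglyMeasurable (by fun_prop)
  rw [highIntegrand_three_halves, abs_div, abs_of_nonneg (by positivity : 0 ≤ y ^ 4)]
  refine le_mul_inv_one_add_sq he (by positivity) (by positivity) (fun hy => ?_) fun hy => ?_
  · have hin : ∀ t, |t - x| ≤ 2 * |y| → t ∈ B := fun t ht =>
      (mem_B_of_abs_sub_le he (by linarith) ht).1
    have hy0 := abs_nonneg y
    rw [w_eq_profile hx, w_eq_profile (hin (x + 2 * y) (by simp [abs_mul])),
      w_eq_profile (hin (x + y) (by simp; linarith)),
      w_eq_profile (hin (x - y) (by simp; linarith)),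
      w_eq_profile (hin (x - 2 * y) (by simp [abs_mul]))]
    exact div_le_of_le_mul₀ (by positivity) (by positivity)
      (abs_fourth_diff_profile_le he (by linarith))
  · have h3 : e ^ 2 ≤ y ^ 2 := by rw [← sq_abs y]; gcongr
    have h5 : 0 < y ^ 2 := lt_of_lt_of_le (by positivity) h3
    have h0 := abs_le.1 (abs_w_le x)
    have h1 := abs_le.1 (abs_w_le (x + 2 * y))
    have h2 := abs_le.1 (abs_w_le (x + y))
    have h3' := abs_le.1 (abs_w_le (x - y))
    have h4 := abs_le.1 (abs_w_le (x - 2 * y))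
    rw [show y ^ 4 = y ^ 2 * y ^ 2 by ring, ← div_div]
    gcongr
    rw [abs_le]
    constructor <;> linarith

/-! ### Half-line integrals and normalization constants -/

open Filter Topology in
/-- The fundamental theorem of calculus on `(0, ∞)`. -/
lemma integral_Ioi_zero_of_tendsto {f f' : ℝ → ℝ} {a b : ℝ}
    (hd : ∀ y ∈ Set.Ioi (0 : ℝ), HasDerivAt f (f' y) y) (hi : IntegrableOn f' (Set.Ioi 0))
    (h0 : Tendsto f (𝓝[>] 0) (𝓝 a)) (h1 : Tendsto f atTop (𝓝 b)) :
    ∫ y in Set.Ioi 0, f' y = b - a := by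
  -- Redefining `f` at `0` by its limit makes it continuous from the right.
  have hc : ContinuousWithinAt (Function.update f 0 a) (Set.Ici 0) 0 := by
    rw [continuousWithinAt_update_same]
    convert h0 using 2
    ext y
    simp only [Set.mem_sdiff, Set.mem_Ici, Set.mem_singleton_iff, Set.mem_Ioi]
    exact ⟨fun h => lt_of_le_of_ne h.1 (Ne.symm h.2), fun h => ⟨h.le, h.ne'⟩⟩
  have := integral_Ioi_of_hasDerivAt_of_tendsto (f' := f') (m := b) hc
    (fun y hy => (hd y hy).congr_of_eventuallyEq ?_) hi ?_
  · simpa using this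
  · filter_upwards [isOpen_Ioi.mem_nhds hy] with u hu
    exact Function.update_of_ne (ne_of_gt hu) _ _
  · refine h1.congr' ?_
    filter_upwards [eventually_gt_atTop 0] with u hu
    exact (Function.update_of_ne (ne_of_gt hu) _ _).symm

lemma Gamma_neg_half : Real.Gamma (-(1 / 2)) = -2 * √Real.pi := by
  have := Real.Gamma_add_one (s := -(1 / 2)) (by norm_num)
  rw [show -(1 / 2 : ℝ) + 1 = 1 / 2 by norm_num, Real.Gamma_one_half_eq] at this
  linarith

lemma Gamma_neg_three_halves : Real.Gamma (-(3 / 2)) = 4 / 3 * √Real.pi := by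
  have := Real.Gamma_add_one (s := -(3 / 2)) (by norm_num)
  rw [show -(3 / 2 : ℝ) + 1 = -(1 / 2) by norm_num, Gamma_neg_half] at this
  linarith

lemma four_rpow_half : (4 : ℝ) ^ (1 / 2 : ℝ) = 2 := by
  rw [← Real.sqrt_eq_rpow, show (4 : ℝ) = 2 ^ 2 by norm_num, Real.sqrt_sq (by norm_num)]

lemma lowConst_half : lowConst (1 / 2) = (2 * Real.pi)⁻¹ := by
  have h := Real.sqrt_pos.2 Real.pi_pos
  have h2 := Real.sq_sqrt Real.pi_pos.le
  rw [lowConst, Gamma_neg_half, four_rpow_half, ← Real.sqrt_eq_rpow,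
    show (1 / 2 : ℝ) + 1 / 2 = 1 by norm_num, Real.Gamma_one]
  have : Real.pi ≠ 0 := Real.pi_ne_zero
  field_simp
  rw [h2]

lemma highConst_three_halves : highConst (3 / 2) = 3 / (4 * Real.pi) := by
  have h := Real.sqrt_pos.2 Real.pi_pos
  have h2 := Real.sq_sqrt Real.pi_pos.le
  rw [highConst, Gamma_neg_three_halves, ← Real.sqrt_eq_rpow,
    show (1 / 2 : ℝ) + 3 / 2 = 2 by norm_num, Real.Gamma_two,
    show (1 : ℝ) - 3 / 2 = -(1 / 2) by norm_num, Real.rpow_neg (by norm_num), four_rpow_half]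
  have : Real.pi ≠ 0 := Real.pi_ne_zero
  norm_num
  field_simp
  rw [h2]

lemma fracLapLow_half (u : ℝ → ℝ) (x : ℝ) :
    fracLapLow (1 / 2) u x = Real.pi⁻¹ * ∫ y in Set.Ioi 0, lowIntegrand (1 / 2) u x y := by
  have h : ∀ y, lowIntegrand (1 / 2) u x y = lowIntegrand (1 / 2) u x |y| := by
    intro y
    rcases abs_choice y with h | h
    · rw [h]
    · rw [h, lowIntegrand_half, lowIntegrand_half, neg_sq, sub_neg_eq_add, ← sub_eq_add_neg]
      ring
  rw [fracLapLow, lowConst_half, integral_congr_ae (Filter.Eventually.of_forall h),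
    integral_comp_abs (f := lowIntegrand (1 / 2) u x)]
  ring

lemma fracLapHigh_three_halves (u : ℝ → ℝ) (x : ℝ) :
    fracLapHigh (3 / 2) u x =
      3 / (2 * Real.pi) * ∫ y in Set.Ioi 0, highIntegrand (3 / 2) u x y := by
  have h : ∀ y, highIntegrand (3 / 2) u x y = highIntegrand (3 / 2) u x |y| := by
    intro y
    rcases abs_choice y with h | h
    · rw [h]
    · rw [h, highIntegrand_three_halves, highIntegrand_three_halves, mul_neg, sub_neg_eq_add,
        sub_neg_eq_add, ← sub_eq_add_neg, ← sub_eq_add_neg, Even.neg_pow (by decide)]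
      ring
  rw [fracLapHigh, highConst_three_halves, integral_congr_ae (Filter.Eventually.of_forall h),
    integral_comp_abs (f := highIntegrand (3 / 2) u x)]
  have : Real.pi ≠ 0 := Real.pi_ne_zero
  field_simp
  norm_num

lemma integrableOn_Ioi_inv_pow {c : ℝ} (hc : 0 < c) {n : ℕ} (hn : 1 < n) :
    IntegrableOn (fun y : ℝ => 1 / y ^ n) (Set.Ioi c) := by
  have hn' : (1 : ℝ) < n := by exact_mod_cast hn
  refine (integrableOn_Ioi_rpow_of_lt (a := -n) (by linarith) hc).congr_fun (fun y hy => ?_)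
    measurableSet_Ioi
  have : 0 < y := hc.trans hy
  simp only
  rw [Real.rpow_neg this.le, Real.rpow_natCast, one_div]

lemma integral_Ioi_inv_pow {c : ℝ} (hc : 0 < c) {n : ℕ} (hn : 0 < n) :
    ∫ y in Set.Ioi c, 1 / y ^ (n + 1) = 1 / (n * c ^ n) := by
  have hn' : (0 : ℝ) < n := by exact_mod_cast hn
  rw [setIntegral_congr_fun (g := fun y : ℝ => y ^ (-(n + 1) : ℝ)) measurableSet_Ioi,
    integral_Ioi_rpow_of_lt (by linarith) hc]
  · rw [show -((n : ℝ) + 1) + 1 = -n by ring, Real.rpow_neg hc.le, Real.rpow_natCast]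
    field_simp
  · intro y hy
    have : 0 < y := hc.trans hy
    simp only
    rw [Real.rpow_neg this.le, ← Nat.cast_add_one, Real.rpow_natCast, one_div]

/-! ### Half-Laplacian of `slope` and of `w'` -/

/-- The antiderivative of `slope t / (t - x) ^ 2`. -/
noncomputable def slopePrim (x t : ℝ) : ℝ :=
  -slope t / (t - x) + semi x * logKer x t - semi t + x * Real.arcsin t

lemma continuousAt_slopePrim {x t : ℝ} (hxt : t ≠ x) : ContinuousAt (slopePrim x) t := by
  have p4 : t - x ≠ 0 := sub_ne_zero.2 hxt
  have h1 := continuous_slope.continuousAt (x := t)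
  have h2 := continuousAt_logKer hxt
  have h3 := continuous_semi.continuousAt (x := t)
  have h4 := Real.continuous_arcsin.continuousAt (x := t)
  unfold slopePrim
  exact (((h1.neg.div (by fun_prop) p4).add (continuousAt_const.mul h2)).sub h3).add
    (continuousAt_const.mul h4)

/-- Integration by parts leaves `-semi t / (t - x)`, whose antiderivative is `semi x * logKer x t -
semi t + x * arcsin t`. -/
lemma hasDerivAt_slopePrim {x t : ℝ} (hx : x ∈ B) (hxt : t ≠ x) :
    HasDerivAt (slopePrim x) (slope t / (t - x) ^ 2) t := by
  have key : ∀ I : Set ℝ, IsOpen I → I.OrdConnected → x ∉ I → t ∈ I →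
      HasDerivAt (slopePrim x) (slope t / (t - x) ^ 2) t := by
    intro I hI hIc hxI htI
    have hne : ∀ u ∈ I, u ≠ x := fun u hu h => hxI (h ▸ hu)
    refine hasDerivAt_of_off_countable (g := fun t => slope t / (t - x) ^ 2) hI hIc countable_pair
      (fun u hu => (continuousAt_slopePrim (hne u hu)).continuousWithinAt) ?_ ?_ htI
    · exact continuous_slope.continuousOn.div (by fun_prop)
        fun u hu => pow_ne_zero _ (sub_ne_zero.2 (hne u hu))
    · intro u hu hup
      obtain ⟨h1, h2⟩ := ne_of_notMem_pair hup
      have p4 : u - x ≠ 0 := sub_ne_zero.2 (hne u hu)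
      refine (((((hasDerivAt_slope u).neg.div ((hasDerivAt_id u).sub_const x) p4).add
        ((hasDerivAt_logKer hx hup (hne u hu)).const_mul (semi x))).sub
        (hasDerivAt_semi h1 h2)).add ((Real.hasDerivAt_arcsin h1 h2).const_mul x)).congr_deriv ?_
      change (- -semi u * (u - x) - (-slope u) * 1) / (u - x) ^ 2 + semi x * _ - _ +
        x * (1 / semi u) = _
      have e1 := semi_sq hx
      by_cases hB : u ∈ B
      · have e2 := semi_sq hB
        have := semi_pos hB
        field_simp
        linear_combination (u - x) * e2 - (u - x) * e1
      · rw [semi_eq_zero hB]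
        simp
  rcases lt_or_gt_of_ne hxt with h | h
  · exact key (Set.Iio x) isOpen_Iio Set.ordConnected_Iio (by simp) h
  · exact key (Set.Ioi x) isOpen_Ioi Set.ordConnected_Ioi (by simp) h

open Filter Topology in
-- The logarithmic singularities on the two sides of `x` cancel.
lemma tendsto_logKer_sub {x : ℝ} (hx : x ∈ B) :
    Tendsto (fun y => logKer x (x - y) - logKer x (x + y)) (𝓝[>] 0) (𝓝 0) := by
  have hs := continuous_semi
  have c1 : ContinuousAt (fun y => Real.log (1 - x * (x - y) + semi x * semi (x - y)) -
      Real.log (1 - x * (x + y) + semi x * semi (x + y))) 0 := by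
    have h2 := one_sub_mul_pos hx hx
    have h3 := semi_nonneg x
    have h4 : 1 - x * x + semi x * semi x ≠ 0 := by positivity
    refine ContinuousAt.sub (ContinuousAt.log (by fun_prop) ?_)
      (ContinuousAt.log (by fun_prop) ?_) <;> simpa using h4
  have c2 := c1.tendsto.mono_left (nhdsWithin_le_nhds (s := Set.Ioi 0))
  simp only [sub_zero, add_zero, sub_self] at c2
  refine c2.congr' ?_
  have m1 : ∀ᶠ y in 𝓝 (0 : ℝ), x - y ∈ B :=
    (by fun_prop : ContinuousAt (fun y => x - y) 0).eventually_mem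
      (isOpen_B.mem_nhds (by simpa using hx))
  have m2 : ∀ᶠ y in 𝓝 (0 : ℝ), x + y ∈ B :=
    (by fun_prop : ContinuousAt (fun y => x + y) 0).eventually_mem
      (isOpen_B.mem_nhds (by simpa using hx))
  filter_upwards [nhdsWithin_le_nhds m1, nhdsWithin_le_nhds m2, self_mem_nhdsWithin] with y h1 h2 h3
  have h3 : 0 < y := h3
  rw [logKer_eq_log hx h1 (by linarith), logKer_eq_log hx h2 (by linarith),
    show x - y - x = -y by ring, Real.log_neg_eq_log, show x + y - x = y by ring]
  ring

open Filter Topology in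
lemma integral_lowIntegrand_slope {x : ℝ} (hx : x ∈ B) :
    ∫ y in Set.Ioi 0, lowIntegrand (1 / 2) slope x y = -(Real.pi * x) := by
  have hs := continuous_semi
  have hsl := continuous_slope
  have has := Real.continuous_arcsin
  have hd : ∀ y ∈ Set.Ioi (0 : ℝ),
      HasDerivAt (fun y => -(2 * slope x) / y - slopePrim x (x + y) + slopePrim x (x - y))
        (lowIntegrand (1 / 2) slope x y) y := by
    intro y hy
    have hy : 0 < y := hy
    refine ((((hasDerivAt_const y (-(2 * slope x))).div (hasDerivAt_id y) hy.ne').sub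
      ((hasDerivAt_slopePrim hx (by linarith : x + y ≠ x)).comp_const_add x y)).add
      ((hasDerivAt_slopePrim hx (by linarith : x - y ≠ x)).comp_const_sub x y)).congr_deriv ?_
    rw [lowIntegrand_half]
    simp only [id, add_sub_cancel_left, show x - y - x = -y by ring, neg_sq]
    field_simp
    ring
  rw [integral_Ioi_zero_of_tendsto (a := 0) (b := -(Real.pi * x)) hd
    (integrable_lowIntegrand_slope hx).integrableOn, sub_zero]
  · have t1 : Tendsto (fun y : ℝ => y⁻¹ * ((slope (x + y) + slope (x - y)) - 2 * slope x))
        (𝓝[>] 0) (𝓝 0) := by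
      have d : HasDerivAt (fun y => slope (x + y) + slope (x - y)) 0 0 := by
        refine (((hasDerivAt_slope (x + 0)).comp_const_add x 0).add
          ((hasDerivAt_slope (x - 0)).comp_const_sub x 0)).congr_deriv ?_
        simp
      have := d.tendsto_slope_zero_right
      simp only [smul_eq_mul, zero_add, add_zero, sub_zero] at this
      simpa only [two_mul] using this
    have t2 : Tendsto (fun y : ℝ => semi (x + y) - semi (x - y) +
        x * (Real.arcsin (x - y) - Real.arcsin (x + y))) (𝓝[>] 0) (𝓝 0) := by
      have : ContinuousAt (fun y : ℝ => semi (x + y) - semi (x - y) +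
        x * (Real.arcsin (x - y) - Real.arcsin (x + y))) 0 := by fun_prop
      simpa using this.tendsto.mono_left (nhdsWithin_le_nhds (s := Set.Ioi 0))
    have t3 := (t1.add ((tendsto_logKer_sub hx).const_mul (semi x))).add t2
    simp only [mul_zero, add_zero] at t3
    refine t3.congr' ?_
    filter_upwards [self_mem_nhdsWithin] with y hy
    have hy : 0 < y := hy
    rw [slopePrim, slopePrim, show x + y - x = y by ring, show x - y - x = -y by ring]
    field_simp
    ring
  · have t : Tendsto (fun y : ℝ => -(2 * slope x) / y - Real.pi * x) atTop
        (𝓝 (0 - Real.pi * x)) :=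
      (tendsto_const_nhds.div_atTop tendsto_id).sub_const _
    rw [zero_sub] at t
    refine t.congr' ?_
    -- For `y ≥ 2` both points lie outside `B`: the two `slope` terms cancel, and each arcsine
    -- contributes `-(π/2) * x`.
    filter_upwards [eventually_ge_atTop 2] with y hy
    have h1 : 1 ≤ x + y := by linarith [hx.1]
    have h2 : x - y ≤ -1 := by linarith [hx.2]
    have n1 : x + y ∉ B := fun h => absurd h.2 (not_lt.2 h1)
    have n2 : x - y ∉ B := fun h => absurd h.1 (not_lt.2 h2)
    rw [slopePrim, slopePrim, slope, slope, slope, logKer_eq_zero n1, logKer_eq_zero n2,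
      semi_eq_zero n1, semi_eq_zero n2, Real.arcsin_of_one_le h1, Real.arcsin_of_le_neg_one h2,
      show x + y - x = y by ring, show x - y - x = -y by ring]
    field_simp
    ring

/-- Isolates the jump at `1`. Oddness transfers it to `-1`, so no two-sided version is needed. -/
lemma wDeriv_of_gt {t : ℝ} (ht : -1 < t) :
    wDeriv t = slope t + (Set.Ici 1).indicator (fun _ => Real.pi / 4) t := by
  by_cases h : t < 1
  · rw [wDeriv_eq ⟨ht, h⟩, Set.indicator_of_notMem (by simpa using h), add_zero]
  · have h := not_lt.1 h
    have n : t ∉ B := fun h' => absurd h'.2 (not_lt.2 h)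
    rw [wDeriv_eq_zero n, Set.indicator_of_mem (by simpa using h), slope, semi_eq_zero n,
      Real.arcsin_of_one_le h]
    ring

lemma wDeriv_neg (t : ℝ) : wDeriv (-t) = -wDeriv t := by
  have hB : -t ∈ B ↔ t ∈ B := by rw [mem_B_iff, mem_B_iff, abs_neg]
  by_cases ht : t ∈ B
  · rw [wDeriv_eq ht, wDeriv_eq (hB.2 ht), slope_neg]
  · rw [wDeriv_eq_zero ht, wDeriv_eq_zero (mt hB.1 ht), neg_zero]

lemma integral_lowIntegrand_wDeriv {x : ℝ} (hx : x ∈ B) :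
    ∫ y in Set.Ioi 0, lowIntegrand (1 / 2) wDeriv x y =
      -(Real.pi * x) - Real.pi / 4 * (1 / (1 - x)) + Real.pi / 4 * (1 / (1 + x)) := by
  have h1 : 0 < 1 - x := by linarith [hx.2]
  have h2 : 0 < 1 + x := by linarith [hx.1]
  have hind : ∀ c : ℝ, 0 < c →
      IntegrableOn ((Set.Ici c).indicator fun y : ℝ => 1 / y ^ 2) (Set.Ioi 0) ∧
      ∫ y in Set.Ioi 0, (Set.Ici c).indicator (fun y : ℝ => 1 / y ^ 2) y = 1 / c := by
    intro c hc
    constructor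
    · refine Integrable.integrableOn ((integrable_indicator_iff measurableSet_Ici).2 ?_)
      rw [integrableOn_Ici_iff_integrableOn_Ioi]
      exact integrableOn_Ioi_inv_pow hc (by norm_num)
    · rw [setIntegral_indicator measurableSet_Ici,
        Set.inter_eq_right.2 (Set.Ici_subset_Ioi.2 hc), integral_Ici_eq_integral_Ioi]
      simpa using integral_Ioi_inv_pow hc (n := 1) (by norm_num)
  -- For `y > 0` both `x + y` and `y - x` exceed `-1`; they pass `1` at `y = 1 - x` and `y = 1 + x`,
  -- where the jumps enter.
  have e : Set.EqOn (lowIntegrand (1 / 2) wDeriv x) (fun y => lowIntegrand (1 / 2) slope x y -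
      Real.pi / 4 * (Set.Ici (1 - x)).indicator (fun y : ℝ => 1 / y ^ 2) y +
      Real.pi / 4 * (Set.Ici (1 + x)).indicator (fun y : ℝ => 1 / y ^ 2) y) (Set.Ioi 0) := by
    intro y hy
    have hy : 0 < y := hy
    simp only
    rw [lowIntegrand_half, lowIntegrand_half, wDeriv_eq hx, wDeriv_of_gt (t := x + y)
      (by linarith), show x - y = -(y - x) by ring, wDeriv_neg, wDeriv_of_gt (t := y - x)
      (by linarith), slope_neg]
    have i1 : (Set.Ici 1).indicator (fun _ => Real.pi / 4) (x + y) =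
        Real.pi / 4 * y ^ 2 * (Set.Ici (1 - x)).indicator (fun y : ℝ => 1 / y ^ 2) y := by
      by_cases h : 1 ≤ x + y
      · rw [Set.indicator_of_mem (by simpa using h),
          Set.indicator_of_mem (by simp only [Set.mem_Ici]; linarith)]
        field_simp
      · rw [Set.indicator_of_notMem (by simpa using h),
          Set.indicator_of_notMem (by simp only [Set.mem_Ici]; intro h'; apply h; linarith)]
        ring
    have i2 : (Set.Ici 1).indicator (fun _ => Real.pi / 4) (y - x) =
        Real.pi / 4 * y ^ 2 * (Set.Ici (1 + x)).indicator (fun y : ℝ => 1 / y ^ 2) y := by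
      by_cases h : 1 ≤ y - x
      · rw [Set.indicator_of_mem (by simpa using h),
          Set.indicator_of_mem (by simp only [Set.mem_Ici]; linarith)]
        field_simp
      · rw [Set.indicator_of_notMem (by simpa using h),
          Set.indicator_of_notMem (by simp only [Set.mem_Ici]; intro h'; apply h; linarith)]
        ring
    rw [i1, i2]
    field_simp
    ring
  obtain ⟨a1, b1⟩ := hind _ h1
  obtain ⟨a2, b2⟩ := hind _ h2
  have a0 := (integrable_lowIntegrand_slope hx).integrableOn (s := Set.Ioi 0)
  rw [setIntegral_congr_fun measurableSet_Ioi e,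
    integral_add (f := fun y => lowIntegrand (1 / 2) slope x y - Real.pi / 4 *
      (Set.Ici (1 - x)).indicator (fun y : ℝ => 1 / y ^ 2) y) (a0.sub (a1.const_mul _))
      (a2.const_mul _), integral_sub a0 (a1.const_mul _),
    integral_const_mul, integral_const_mul, b1, b2, integral_lowIntegrand_slope hx]

lemma fracLapLow_wDeriv {x : ℝ} (hx : x ∈ B) :
    fracLapLow (1 / 2) wDeriv x = -x - 1 / (4 * (1 - x)) + 1 / (4 * (1 + x)) := by
  have h1 : 1 - x ≠ 0 := by linarith [hx.2]
  have h2 : 1 + x ≠ 0 := by linarith [hx.1]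
  have : Real.pi ≠ 0 := Real.pi_ne_zero
  rw [fracLapLow_half, integral_lowIntegrand_wDeriv hx]
  field_simp

/-! ### Half-Laplacian of the semicircle at the origin -/

open Filter Topology in
lemma fracLapLow_semi_zero : fracLapLow (1 / 2) semi 0 = 1 := by
  have h0 : (0 : ℝ) ∈ B := by simp [B]
  have hs := continuous_semi
  have has := Real.continuous_arcsin
  have hd : ∀ y ∈ Set.Ioi (0 : ℝ),
      HasDerivAt (fun y => 2 * ((semi y - 1) / y + Real.arcsin y))
        (lowIntegrand (1 / 2) semi 0 y) y := by
    intro y hy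
    refine hasDerivAt_of_off_countable isOpen_Ioi Set.ordConnected_Ioi countable_pair ?_ ?_ ?_ hy
    · refine continuousOn_const.mul (ContinuousOn.add (ContinuousOn.div (by fun_prop) (by fun_prop)
        fun u hu => ne_of_gt hu) has.continuousOn)
    · rw [show lowIntegrand (1 / 2) semi 0 = _ from funext (lowIntegrand_half semi 0)]
      exact ContinuousOn.div (by fun_prop) (by fun_prop) fun u hu => pow_ne_zero _ (ne_of_gt hu)
    · intro u hu hup
      have hu : 0 < u := hu
      obtain ⟨h1, h2⟩ := ne_of_notMem_pair hup
      refine (((((hasDerivAt_semi h1 h2).sub_const 1).div (hasDerivAt_id u) hu.ne').add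
        (Real.hasDerivAt_arcsin h1 h2)).const_mul 2).congr_deriv ?_
      rw [lowIntegrand_half, zero_add, zero_sub, semi_neg, show semi 0 = 1 by simp [semi]]
      simp only [id]
      change 2 * (_ + 1 / semi u) = _
      by_cases hB : u ∈ B
      · have := semi_pos hB
        field_simp
        ring
      · rw [semi_eq_zero hB]
        field_simp
        simp
  rw [fracLapLow_half, integral_Ioi_zero_of_tendsto (a := 0) (b := Real.pi) hd
    (integrable_lowIntegrand_semi h0).integrableOn, sub_zero, inv_mul_cancel₀ Real.pi_ne_zero]
  · have t1 := (hasDerivAt_semi (t := 0) (by norm_num) (by norm_num)).tendsto_slope_zero_right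
    have t2 : Tendsto Real.arcsin (𝓝[>] 0) (𝓝 0) := by
      simpa using (has.tendsto 0).mono_left (nhdsWithin_le_nhds (s := Set.Ioi 0))
    have t3 := (t1.add t2).const_mul 2
    simp only [zero_div, neg_zero, add_zero, mul_zero] at t3
    refine t3.congr fun y => ?_
    rw [zero_add, show semi 0 = 1 by simp [semi], smul_eq_mul, inv_mul_eq_div]
  · have t : Tendsto (fun y : ℝ => 2 * (-1 / y + Real.pi / 2)) atTop
        (𝓝 (2 * (0 + Real.pi / 2))) :=
      ((tendsto_const_nhds.div_atTop tendsto_id).add_const _).const_mul _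
    rw [show 2 * (0 + Real.pi / 2) = Real.pi by ring] at t
    refine t.congr' ?_
    filter_upwards [eventually_ge_atTop 1] with y hy
    have n1 : y ∉ B := fun h => absurd h.2 (not_lt.2 hy)
    rw [semi_eq_zero n1, Real.arcsin_of_one_le hy, zero_sub]

/-! ### Differentiating the half-Laplacian of `w` -/

lemma measurable_lowIntegrand_wDeriv (x : ℝ) : Measurable (lowIntegrand (1 / 2) wDeriv x) :=
  measurable_lowIntegrand measurable_wDeriv x

/-- Near a point of `B`, the integrand of `(-Δ)^{1/2} w` is Lipschitz in that point. -/
lemma abs_lowIntegrand_w_sub_le {a e x x' y : ℝ} (he : 0 < e) (ha : |a| + 3 * e ≤ 1)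
    (hx : x ∈ Metric.ball a e) (hx' : x' ∈ Metric.ball a e) :
    |lowIntegrand (1 / 2) w x y - lowIntegrand (1 / 2) w x' y| ≤
      (e⁻¹ * (1 + e ^ 2) + 8 * (1 + 1 / e ^ 2)) * (1 + y ^ 2)⁻¹ * |x - x'| := by
  have hr : ∀ A B : ℝ, (e⁻¹ * A + 8 * B) * (1 + y ^ 2)⁻¹ * |x - x'| =
      (e⁻¹ * |x - x'| * A + 8 * |x - x'| * B) * (1 + y ^ 2)⁻¹ := by intros; ring
  rw [hr, lowIntegrand_half, lowIntegrand_half, ← sub_div, abs_div, abs_of_nonneg (sq_nonneg y)]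
  -- One `e` in `3 * e` is for the ball, one for the step `y`, one for the distance left to the
  -- boundary. For larger steps `8 = 4 * 2`: coefficient sum times the Lipschitz constant of `w`.
  refine le_mul_inv_one_add_sq he (by positivity) (by positivity) (fun hy => ?_) fun hy => ?_
  · refine div_le_of_le_mul₀ (sq_nonneg y) (by positivity) ?_
    have hin : ∀ z ∈ Metric.ball a e, |z| + |y| + e ≤ 1 := by
      intro z hz
      rw [Metric.mem_ball, Real.dist_eq] at hz
      have : |z| ≤ |z - a| + |a| := by simpa using abs_add_le (z - a) a
      linarith
    have hmem : ∀ z ∈ Metric.ball a e, ∀ t, |t - z| ≤ |y| → t ∉ ({-1, 1} : Set ℝ) :=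
      fun z hz t ht => mem_compl_pair (mem_B_of_abs_sub_le he (hin z hz) ht).1
    have := Convex.norm_image_sub_le_of_norm_hasDerivWithin_le
      (f := fun z => 2 * w z - w (z + y) - w (z - y))
      (f' := fun z => 2 * wDeriv z - wDeriv (z + y) - wDeriv (z - y)) (C := e⁻¹ * y ^ 2)
      (fun z hz => ((((hasDerivAt_w (hmem z hz z (by simp))).const_mul 2).sub
        ((hasDerivAt_w (hmem z hz (z + y) (by simp))).comp_add_const z y)).sub
        ((hasDerivAt_w (hmem z hz (z - y) (by simp))).comp_sub_const z y)).hasDerivWithinAt)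
      (fun z hz => abs_diff_wDeriv_le he (hin z hz)) (convex_ball a e) hx' hx
    simp only [Real.norm_eq_abs] at this
    linarith
  · gcongr
    have h0 := abs_le.1 (abs_w_sub_le x' x)
    have h1 := abs_le.1 (abs_w_sub_le (x' + y) (x + y))
    have h2 := abs_le.1 (abs_w_sub_le (x' - y) (x - y))
    rw [add_sub_add_right_eq_sub] at h1
    rw [sub_sub_sub_cancel_right] at h2
    rw [abs_le]
    constructor <;> linarith

lemma hasDerivAt_fracLapLow_w {a : ℝ} (ha : a ∈ B) :
    HasDerivAt (fracLapLow (1 / 2) w) (fracLapLow (1 / 2) wDeriv a) a := by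
  have ha1 := mem_B_iff.1 ha
  have he : 0 < (1 - |a|) / 3 := by linarith
  set e := (1 - |a|) / 3 with hedef
  unfold fracLapLow
  refine HasDerivAt.const_mul _ ?_
  refine (hasDerivAt_integral_of_dominated_loc_of_lip (F := fun x y => lowIntegrand (1 / 2) w x y)
    (bound := fun y => (e⁻¹ * (1 + e ^ 2) + 8 * (1 + 1 / e ^ 2)) * (1 + y ^ 2)⁻¹)
    (Metric.ball_mem_nhds a he)
    (Filter.Eventually.of_forall fun x =>
      (measurable_lowIntegrand continuous_w.measurable x).aestronglyMeasurable)
    (integrable_lowIntegrand_w ha) (measurable_lowIntegrand_wDeriv a).aestronglyMeasurable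
    (Filter.Eventually.of_forall fun y => ?_) (integrable_inv_one_add_sq.const_mul _) ?_).2
  · refine LipschitzOnWith.of_dist_le_mul fun x hx x' hx' => ?_
    rw [Real.dist_eq, Real.dist_eq, Real.coe_nnabs]
    exact (abs_lowIntegrand_w_sub_le he (by linarith) hx hx').trans
      (mul_le_mul_of_nonneg_right (le_abs_self _) (abs_nonneg _))
  -- Only for these four `y` does `a + y` or `a - y` hit a corner of `w`.
  · have hfin : ({1 - a, -1 - a, a - 1, a + 1} : Set ℝ).Finite := Set.toFinite _
    filter_upwards [hfin.countable.ae_notMem volume] with y hy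
    simp only [Set.mem_insert_iff, Set.mem_singleton_iff, not_or] at hy
    obtain ⟨n1, n2, n3, n4⟩ := hy
    have p1 : a + y ∉ ({-1, 1} : Set ℝ) := by
      simp only [Set.mem_insert_iff, Set.mem_singleton_iff, not_or]
      exact ⟨fun h => n2 (by linarith), fun h => n1 (by linarith)⟩
    have p2 : a - y ∉ ({-1, 1} : Set ℝ) := by
      simp only [Set.mem_insert_iff, Set.mem_singleton_iff, not_or]
      exact ⟨fun h => n4 (by linarith), fun h => n3 (by linarith)⟩
    simp only [lowIntegrand_half]
    exact ((((hasDerivAt_w (mem_compl_pair ha)).const_mul 2).sub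
        ((hasDerivAt_w p1).comp_add_const a y)).sub
        ((hasDerivAt_w p2).comp_sub_const a y)).div_const _

lemma deriv_fracLapLow_w {x : ℝ} (hx : x ∈ B) :
    deriv (fracLapLow (1 / 2) w) x = -x - 1 / (4 * (1 - x)) + 1 / (4 * (1 + x)) := by
  rw [(hasDerivAt_fracLapLow_w hx).deriv, fracLapLow_wDeriv hx]

lemma contDiffOn_fracLapLow_w : ContDiffOn ℝ 2 (fracLapLow (1 / 2) w) B := by
  rw [show (2 : WithTop ℕ∞) = 1 + 1 by norm_num, contDiffOn_succ_iff_deriv_of_isOpen isOpen_B]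
  refine ⟨fun x hx => (hasDerivAt_fracLapLow_w hx).differentiableAt.differentiableWithinAt,
    by simp, ?_⟩
  refine ContDiffOn.congr ?_ fun x hx => deriv_fracLapLow_w hx
  refine (contDiffOn_id.neg.sub (contDiffOn_const.div (by fun_prop) fun x hx => ?_)).add
    (contDiffOn_const.div (by fun_prop) fun x hx => ?_)
  · have := hx.2
    exact ne_of_gt (by linarith)
  · have := hx.1
    exact ne_of_gt (by linarith)

lemma laplacian_fracLapLow_w_zero : (Δ (fracLapLow (1 / 2) w)) 0 = -(3 / 2) := by
  rw [InnerProductSpace.laplacian_eq_iteratedDeriv_real, iteratedDeriv_succ, iteratedDeriv_one]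
  have h0 : (0 : ℝ) ∈ B := by simp [B]
  have : deriv (fracLapLow (1 / 2) w) =ᶠ[nhds 0]
      fun x => -x - 1 / (4 * (1 - x)) + 1 / (4 * (1 + x)) := by
    filter_upwards [isOpen_B.mem_nhds h0] with x hx using deriv_fracLapLow_w hx
  rw [this.deriv_eq]
  have d1 : HasDerivAt (fun x : ℝ => 4 * (1 - x)) (-4) 0 := by
    simpa using ((hasDerivAt_id (0 : ℝ)).const_sub 1).const_mul 4
  have d2 : HasDerivAt (fun x : ℝ => 4 * (1 + x)) 4 0 := by
    simpa using ((hasDerivAt_id (0 : ℝ)).const_add 1).const_mul 4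
  refine ((((hasDerivAt_id (0 : ℝ)).neg.sub ((hasDerivAt_const 0 1).div d1 (by norm_num))).add
    ((hasDerivAt_const 0 1).div d2 (by norm_num))).congr_deriv ?_).deriv
  norm_num

/-! ### The value of `(-Δ)^{3/2} w` at the origin -/

/-- The second order Taylor remainder of `w` at `0`. -/
noncomputable def wRem (t : ℝ) : ℝ := w t - w 0 + t ^ 2 / 2

lemma profile_zero : profile 0 = Real.pi / 4 - 1 / 3 := by
  simp [profile, semi]; ring

lemma w_zero : w 0 = Real.pi / 4 - 1 / 3 := by
  rw [w_eq_profile (by simp [B]), profile_zero]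

/-- In `B` the second derivative is `1 - semi t ≥ 0`, with zero value and slope at `0`. Beyond, `t²
/ 2 ≥ 1/2` exceeds `w 0 = π/4 - 1/3`. -/
lemma wRem_nonneg {t : ℝ} (ht : 0 < t) : 0 ≤ wRem t := by
  by_cases h : t < 1
  · have m1 : Monotone fun t => slope t + t := by
      have hd : ∀ t, HasDerivAt (fun t => slope t + t) (-semi t + 1) t :=
        fun t => (hasDerivAt_slope t).add (hasDerivAt_id t)
      refine monotone_of_deriv_nonneg (fun t => (hd t).differentiableAt) fun t => ?_
      rw [(hd t).deriv]
      linarith [semi_le_one t]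
    have hd : ∀ t, HasDerivAt (fun t => profile t + t ^ 2 / 2) (slope t + t) t := fun t =>
      ((hasDerivAt_profile t).add (((hasDerivAt_id t).pow 2).div_const 2)).congr_deriv (by simp)
    have m2 : MonotoneOn (fun t => profile t + t ^ 2 / 2) (Set.Ici 0) := by
      refine monotoneOn_of_deriv_nonneg (convex_Ici 0)
        (fun t _ => (hd t).continuousAt.continuousWithinAt)
        (fun t _ => (hd t).differentiableAt.differentiableWithinAt) fun t ht => ?_
      rw [interior_Ici] at ht
      rw [(hd t).deriv]
      have := m1 (le_of_lt ht)
      simpa [slope] using this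
    have := m2 (Set.mem_Ici.2 le_rfl) (Set.mem_Ici.2 ht.le) ht.le
    rw [wRem, w_eq_profile ⟨by linarith, h⟩, w_eq_profile (by simp [B])]
    simp at this
    linarith
  · have h := not_lt.1 h
    rw [wRem, w_eq_zero fun h' => absurd h'.2 (not_lt.2 h), w_zero]
    nlinarith [Real.pi_lt_d2]

/-- By evenness the second difference at `0` is `-2 * wRem t`, and the second derivative satisfies
`1 - semi s ≤ 1 - semi s ^ 2 = s ^ 2`. -/
lemma abs_wRem_le {t : ℝ} (ht : |t| < 1) : |wRem t| ≤ t ^ 4 := by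
  have key := abs_second_diff_le (x := 0) (y := t) (M := t ^ 2)
    (u := fun t => profile t + t ^ 2 / 2) (u' := fun t => slope t + t)
    (u'' := fun t => -semi t + 1)
    (fun t _ => ((hasDerivAt_profile t).add
      (((hasDerivAt_id t).pow 2).div_const 2)).congr_deriv (by simp))
    (fun t _ => (hasDerivAt_slope t).add (hasDerivAt_id t))
    (fun s hs => by
      rw [sub_zero] at hs
      have h1 := semi_sq (mem_B_iff.2 (hs.trans_lt ht))
      have h2 := semi_le_one s
      have h3 := semi_nonneg s
      have h4 : s ^ 2 ≤ t ^ 2 := sq_le_sq.2 hs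
      rw [abs_of_nonneg (by linarith)]
      nlinarith)
  rw [wRem, w_eq_profile (mem_B_iff.2 ht), w_eq_profile (by simp [B])]
  simp only [zero_add, zero_sub, profile_neg, neg_sq] at key
  have e : 2 * (profile 0 + 0 ^ 2 / 2) - (profile t + t ^ 2 / 2) - (profile t + t ^ 2 / 2) =
      -2 * (profile t - profile 0 + t ^ 2 / 2) := by ring
  rw [e, abs_mul] at key
  norm_num at key
  have := abs_nonneg (profile t - profile 0 + t ^ 2 / 2)
  linarith [show t ^ 2 * t ^ 2 = t ^ 4 by ring]

lemma integrable_wRem : Integrable fun t => wRem t / t ^ 4 := by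
  have hw := continuous_w.measurable
  -- For `|t| > 1/2`, `|wRem t| ≤ 8 + t² / 2 ≤ 33 * t²`.
  refine integrable_of_le (A := 1 * (1 + (1 / 2) ^ 2) + 33 * (1 + 1 / (1 / 2) ^ 2)) ?_ fun t => ?_
  · unfold wRem
    exact Measurable.aestronglyMeasurable (by fun_prop)
  rw [abs_div, abs_of_nonneg (by positivity : 0 ≤ t ^ 4)]
  refine le_mul_inv_one_add_sq (by norm_num) (by norm_num) (by norm_num) (fun hy => ?_)
    fun hy => ?_
  · refine div_le_of_le_mul₀ (by positivity) zero_le_one ?_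
    rw [one_mul]
    exact abs_wRem_le (by linarith)
  · have h3 : (1 / 2) ^ 2 ≤ t ^ 2 := by rw [← sq_abs t]; gcongr
    have h5 : 0 < t ^ 2 := lt_of_lt_of_le (by norm_num) h3
    have h0 := abs_le.1 (abs_w_le 0)
    have h1 := abs_le.1 (abs_w_le t)
    rw [show t ^ 4 = t ^ 2 * t ^ 2 by ring, ← div_div]
    gcongr
    rw [div_le_iff₀ h5, wRem, abs_le]
    constructor <;> nlinarith

/-- The part over `(0, 1]` is dropped by positivity; beyond `1` the remainder is `t² / 2 - w 0`. -/
lemma one_half_sub_le_integral_wRem :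
    1 / 2 - w 0 / 3 ≤ ∫ t in Set.Ioi 0, wRem t / t ^ 4 := by
  have e : ∫ t in Set.Ioi 1, wRem t / t ^ 4 = 1 / 2 - w 0 / 3 := by
    rw [setIntegral_congr_fun (g := fun t : ℝ => 1 / 2 * (1 / t ^ (1 + 1)) -
      w 0 * (1 / t ^ (3 + 1))) measurableSet_Ioi,
      integral_sub ((integrableOn_Ioi_inv_pow one_pos (by norm_num)).const_mul _)
        ((integrableOn_Ioi_inv_pow one_pos (by norm_num)).const_mul _),
      integral_const_mul, integral_const_mul, integral_Ioi_inv_pow one_pos (by norm_num),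
      integral_Ioi_inv_pow one_pos (by norm_num)]
    · norm_num; ring
    · intro t ht
      have ht : 1 < t := ht
      simp only
      rw [wRem, w_eq_zero fun h' => absurd h'.2 (not_lt.2 ht.le)]
      field_simp
      ring
  rw [← e]
  refine setIntegral_mono_set integrable_wRem.integrableOn ?_
    (Set.Ioi_subset_Ioi zero_le_one).eventuallyLE
  rw [Filter.EventuallyLE, ae_restrict_iff' measurableSet_Ioi]
  exact Filter.Eventually.of_forall fun t ht => div_nonneg (wRem_nonneg ht) (by positivity)

/-- The quadratic Taylor part drops out of the fourth difference, which by evenness is `2 * wRem (2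
* y) - 8 * wRem y`; rescaling the first term gives the factor `32 / 2 - 8`. -/
lemma integral_highIntegrand_w_zero :
    ∫ y in Set.Ioi 0, highIntegrand (3 / 2) w 0 y = 8 * ∫ t in Set.Ioi 0, wRem t / t ^ 4 := by
  have e : Set.EqOn (highIntegrand (3 / 2) w 0) (fun y => 32 * (wRem (2 * y) / (2 * y) ^ 4) -
      8 * (wRem y / y ^ 4)) (Set.Ioi 0) := by
    intro y hy
    have hy : 0 < y := hy
    simp only
    rw [highIntegrand_three_halves, zero_add, zero_add, zero_sub, zero_sub, w_neg, w_neg, wRem,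
      wRem]
    field_simp
    ring
  have i2 := integrable_wRem.integrableOn (s := Set.Ioi 0)
  have i1 : IntegrableOn (fun y => wRem (2 * y) / (2 * y) ^ 4) (Set.Ioi 0) :=
    (integrable_wRem.comp_mul_left' two_ne_zero).integrableOn
  rw [setIntegral_congr_fun measurableSet_Ioi e, integral_sub (i1.const_mul _) (i2.const_mul _),
    integral_const_mul, integral_const_mul,
    integral_comp_mul_left_Ioi (fun t => wRem t / t ^ 4) 0 two_pos, mul_zero, smul_eq_mul]
  ring

lemma one_lt_fracLapHigh_w_zero : 1 < fracLapHigh (3 / 2) w 0 := by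
  have hpi := Real.pi_pos
  have h1 := one_half_sub_le_integral_wRem
  have h2 := Real.pi_lt_d2
  rw [w_zero] at h1
  rw [fracLapHigh_three_halves, integral_highIntegrand_w_zero, div_mul_eq_mul_div,
    lt_div_iff₀ (by positivity)]
  linarith

/-! ### Irrelevance of the values at `±1` -/

lemma lowIntegrand_congr_ae {g u : ℝ → ℝ} (h : ∀ z ∉ ({-1, 1} : Set ℝ), g z = u z) {x : ℝ}
    (hx : x ∈ B) : lowIntegrand (1 / 2) g x =ᵐ[volume] lowIntegrand (1 / 2) u x := by
  have hfin : ({1 - x, -1 - x, x - 1, x + 1} : Set ℝ).Finite := Set.toFinite _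
  filter_upwards [hfin.countable.ae_notMem volume] with y hy
  simp only [Set.mem_insert_iff, Set.mem_singleton_iff, not_or] at hy
  obtain ⟨n1, n2, n3, n4⟩ := hy
  rw [lowIntegrand_half, lowIntegrand_half, h x (mem_compl_pair hx), h (x + y), h (x - y)]
  · simp only [Set.mem_insert_iff, Set.mem_singleton_iff, not_or]
    exact ⟨fun h => n4 (by linarith), fun h => n3 (by linarith)⟩
  · simp only [Set.mem_insert_iff, Set.mem_singleton_iff, not_or]
    exact ⟨fun h => n2 (by linarith), fun h => n1 (by linarith)⟩

end FracGreen

theorem lemmaA1 :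
    -- the integrals that define `w` converge
    (∀ z : ℝ, IntegrableOn (fun y => FracGreen.green (1 / 2) z y) FracGreen.B) ∧
    (∀ x : ℝ, IntegrableOn (fun z => FracGreen.green 1 x z * FracGreen.w₁ z) FracGreen.B) ∧
    -- `(-Δ)^{3/2} w` is well defined pointwise in `B`
    ContDiffOn ℝ ∞ FracGreen.w FracGreen.B ∧
    FracGreen.MemWeightedL1 (1 / 2) FracGreen.w ∧
    (∀ x ∈ FracGreen.B, Integrable (FracGreen.highIntegrand (3 / 2) FracGreen.w x)) ∧
    -- `(-Δ)^{3/2} w` is not identically `1` in `B`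
    (∃ x ∈ FracGreen.B, FracGreen.fracLapHigh (3 / 2) FracGreen.w x ≠ 1) ∧
    -- `(-Δ) (-Δ)^{1/2} w` is well defined pointwise in `B`
    (∀ x ∈ FracGreen.B, Integrable (FracGreen.lowIntegrand (1 / 2) FracGreen.w x)) ∧
    ContDiffOn ℝ 2 (FracGreen.fracLapLow (1 / 2) FracGreen.w) FracGreen.B ∧
    -- `w` is smooth off `±1`, so that `-Δ w` is defined there; however it is extended to `±1`,
    -- `(-Δ)^{1/2} (-Δ w)` is well defined in `B` and differs from `(-Δ) (-Δ)^{1/2} w`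
    ContDiffOn ℝ ∞ FracGreen.w {-1, 1}ᶜ ∧
    (∀ g : ℝ → ℝ, (∀ z ∈ ({-1, 1}ᶜ : Set ℝ), g z = -(Δ FracGreen.w) z) →
      (∀ x ∈ FracGreen.B, Integrable (FracGreen.lowIntegrand (1 / 2) g x)) ∧
      ∃ x ∈ FracGreen.B,
        -(Δ (FracGreen.fracLapLow (1 / 2) FracGreen.w)) x ≠
          FracGreen.fracLapLow (1 / 2) g x) := by

  have h0 : (0 : ℝ) ∈ FracGreen.B := by simp [FracGreen.B]
  refine ⟨FracGreen.integrableOn_green_half, FracGreen.integrableOn_green_one,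
    FracGreen.contDiffOn_w.mono fun x hx => FracGreen.mem_compl_pair hx,
    FracGreen.memWeightedL1_w, fun x hx => FracGreen.integrable_highIntegrand_w hx,
    ⟨0, h0, FracGreen.one_lt_fracLapHigh_w_zero.ne'⟩,
    fun x hx => FracGreen.integrable_lowIntegrand_w hx, FracGreen.contDiffOn_fracLapLow_w,
    FracGreen.contDiffOn_w, fun g hg => ?_⟩
  have hg' : ∀ z ∉ ({-1, 1} : Set ℝ), g z = FracGreen.semi z := fun z hz => by
    rw [hg z hz, FracGreen.laplacian_w hz, neg_neg]
  refine ⟨fun x hx => (FracGreen.integrable_lowIntegrand_semi hx).congr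
    (FracGreen.lowIntegrand_congr_ae hg' hx).symm, 0, h0, ?_⟩
  have e : FracGreen.fracLapLow (1 / 2) g 0 =
      FracGreen.fracLapLow (1 / 2) FracGreen.semi 0 := by
    rw [FracGreen.fracLapLow, FracGreen.fracLapLow,
      integral_congr_ae (FracGreen.lowIntegrand_congr_ae hg' h0)]
  -- The two sides are `3/2` and `1`; the excess `1/2` comes from the jumps of `w'` at `±1`.
  rw [e, FracGreen.fracLapLow_semi_zero, FracGreen.laplacian_fracLapLow_w_zero]
  norm_num
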